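/- Let $1<p<\infty$, $p\neq 2$. Let $\ell^p_A$ be the space of power series $f(z)=\sum_{k\ge 0}a_kz^k$ with complex coefficients and $\|f\|_p=\big(\sum_{k}|a_k|^p\big)^{1/p}<\infty$. For $0\ne f\in\ell^p_A$ let $t_f$ be the unique complex number with $\|(1-t_fz)f(z)\|_p=\min_{t\in\mathbb C}\|(1-tz)f(z)\|_p$, and put $$T_{d,p}=\sup\{|t_f| : f\ne 0 \text{ a complex polynomial of degree at most } d\},\qquad \tau_p=\sup_{d\ge 1}T_{d,p}.$$ For $t>0$ consider the extremal recurrence relations $$(pta_k-a_{k+1})\,|a_{k+1}-ta_k|^{p-2}=(p-1)\,a_{k-1}\,|a_k-ta_{k-1}|^{p-2},\qquad a_{-1}=0, \tag{$R_k$}$$ where, if $p<2$, the power $0^{p-2}$ is read as $0$. For every $t>1$ the equation $x^{p-1}(pt-x)=p-1$ has exactly two positive solutions $\xi_1(t)<\xi_2(t)$. There is a unique $\tau>1$ such that, with $\xi_i=\xi_i(\tau)$, $$(p\tau-\xi_1)\,|\xi_1-\tau|^{p-2}=(p\tau-\xi_2)\,|\xi_2-\tau|^{p-2},$$ and $$\tau=\tau_p=\lim_{d\to\infty}T_{d,p}.$$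 Moreover, with $t=\tau_p$, no nonzero $f=\sum a_kz^k\in\ell^p_A$ satisfies $(R_k)$ for all $k\ge 0$, and for no $d\ge0$ does a nonzero polynomial of degree at most $d$ satisfy $(R_k)$ for all $0\le k\le d$. Finally, $\tau_p$ is not attained: $|t_f|\neq\tau_p$ for every nonzero $f\in\ell^p_A$. -/

import Mathlib

noncomputable section

namespace EllPA

/-- Membership in the space of power series with `p`-summable coefficients. -/
def Mem (p : ℝ) (f : PowerSeries ℂ) : Prop :=
  Summable fun k : ℕ => ‖PowerSeries.coeff k f‖ ^ p

/-- The `p`-norm of a power series, `(∑ |a_k| ^ p) ^ (1 / p)`.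
It is used only for members of the space, where the series converges. -/
def norm (p : ℝ) (f : PowerSeries ℂ) : ℝ :=
  (∑' k : ℕ, ‖PowerSeries.coeff k f‖ ^ p) ^ (1 / p)

/-- The power series `(1 - t z) f(z)`. -/
def twist (t : ℂ) (f : PowerSeries ℂ) : PowerSeries ℂ :=
  (1 - PowerSeries.C t * PowerSeries.X) * f

/-- `t = t_f`: the number `t` minimizes `‖(1 - s z) f(z)‖_p` over all complex `s`.
For a nonzero member `f` of the space there is exactly one such `t`. -/
def IsOpt (p : ℝ) (f : PowerSeries ℂ) (t : ℂ) : Prop :=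
  ∀ s : ℂ, norm p (twist t f) ≤ norm p (twist s f)

/-- `T_{d,p}`: the supremum of `|t_f|` over the nonzero complex polynomials `f` of degree at
most `d`. (The set is nonempty and bounded above by `2`.) -/
def T (p : ℝ) (d : ℕ) : ℝ :=
  sSup {r : ℝ | ∃ (f : Polynomial ℂ) (t : ℂ),
    f ≠ 0 ∧ f.natDegree ≤ d ∧ IsOpt p (f : PowerSeries ℂ) t ∧ r = ‖t‖}

/-- `τ_p`: the supremum of `T_{d,p}` over the positive integers `d`. -/
def tau (p : ℝ) : ℝ :=
  ⨆ d : ℕ+, T p d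

/-- The preceding coefficient `a_{k-1}`, with `a_{-1} = 0`. -/
def prev (f : PowerSeries ℂ) : ℕ → ℂ
  | 0 => 0
  | k + 1 => PowerSeries.coeff k f

/-- The `k`-th extremal recurrence relation
`(p t a_k - a_{k+1}) |a_{k+1} - t a_k|^(p-2) = (p-1) a_{k-1} |a_k - t a_{k-1}|^(p-2)`.
For `p < 2` a vanishing base is given the power `0`; this admits more sequences than demanding
that every base with a negative exponent be nonzero. -/
def Rec (p t : ℝ) (f : PowerSeries ℂ) (k : ℕ) : Prop :=
  ((p : ℂ) * t * PowerSeries.coeff k f - PowerSeries.coeff (k + 1) f) *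
      ((‖PowerSeries.coeff (k + 1) f - t * PowerSeries.coeff k f‖ ^ (p - 2) : ℝ) : ℂ) =
    ((p : ℂ) - 1) * prev f k *
      ((‖PowerSeries.coeff k f - t * prev f k‖ ^ (p - 2) : ℝ) : ℂ)

end EllPA

end

/-! Up to the factor -p, the derivative of `‖(1 - t z) f‖ ^ p` in a real parameter t is the sum over
k of `|a_k - t a_{k-1}| ^ (p - 2) ⟨a_k - t a_{k-1}, a_{k-1}⟩`. It vanishes at an optimal parameter
(`IsOpt.tsum_pairing_eq_zero`, after rotating t to the positive axis), so everything rests on the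
sign of this functional.

Suppose each term is at most `c (|a_k| ^ p - |a_{k-1}| ^ p)` for one constant c. The bounds
telescope to zero, with strict inequality at the first nonzero coefficient, so the functional is
negative. For a real ratio `u = a_k / a_{k-1}` this asks that c lie between the maximum of
`ascentRatio` over u > t and the minimum of `descentRatio` over 0 ≤ u < 1. `Separates.inner_le`
shows that such a c also serves complex ratios. The two extremes are taken at ξ₂ and ξ₁, and the
equation for τ says that they agree. The minimum increases with t and the maximum decreases, so they
cross exactly once (`exists_threshold`).

For t ≥ τ the functional is therefore negative on all nonzero f, which gives |t_f| < τ. For 1 < t <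
τ, coefficients that grow with ratio ξ₂ and then decay with ratio ξ₁ make it positive, and convexity
gives |t_f| ≥ t. The recurrence relations telescope the same functional to a nonnegative total,
which excludes solutions at t = τ. -/

namespace EllPA

/-! ### The one-step inequality, from real to complex ratios. -/

/-- The weighted arithmetic-geometric mean inequality in Bernoulli form. -/
theorem succ_mul_rpow_le {m q : ℝ} (hm : 0 < m) (hq : 0 ≤ q) :
    (m + 1) * q ^ m ≤ 1 + m * q ^ (m + 1) := by
  have h := one_add_mul_self_le_rpow_one_add (s := q ^ m - 1) (p := (m + 1) / m)
    (by linarith [Real.rpow_nonneg hq m]) (by rw [le_div_iff₀ hm]; linarith)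
  rw [show 1 + (q ^ m - 1) = q ^ m by ring, ← Real.rpow_mul hq,
    show m * ((m + 1) / m) = m + 1 by field_simp] at h
  have h2 := mul_le_mul_of_nonneg_left h hm.le
  have h3 : m * (1 + (m + 1) / m * (q ^ m - 1)) = (m + 1) * q ^ m - 1 := by
    field_simp; ring
  linarith

/-- Comparison of the values of `x ^ m * (a - x)` on the two sides of its maximum. -/
theorem rpow_mul_sub_le {m a x y : ℝ} (hm : 0 < m) (hy : 0 < y) (hx : 0 ≤ x)
    (h : 0 ≤ ((m + 1) * y - m * a) * (x - y)) :
    x ^ m * (a - x) ≤ y ^ m * (a - y) := by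
  obtain ⟨q, hq, rfl⟩ : ∃ q, 0 ≤ q ∧ x = y * q := ⟨x / y, by positivity, by field_simp⟩
  rw [Real.mul_rpow hy.le hq, mul_assoc]
  refine mul_le_mul_of_nonneg_left ?_ (by positivity)
  have h1 := succ_mul_rpow_le hm hq
  rw [Real.rpow_add_one' hq (by linarith)] at h1
  -- `q ^ m - 1` has the sign of `x - y = y (q - 1)`, so the sign hypothesis carries over to it.
  have h2 : m * a * (q ^ m - 1) ≤ (m + 1) * y * (q ^ m - 1) := by
    rcases lt_trichotomy q 1 with hq1 | rfl | hq1
    · have := Real.rpow_le_one hq hq1.le hm.le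
      have : (m + 1) * y - m * a ≤ 0 := by
        by_contra! h'
        have : y * q - y < 0 := by nlinarith
        nlinarith
      nlinarith
    · simp
    · have := Real.one_le_rpow hq1.le hm.le
      have : 0 ≤ (m + 1) * y - m * a := by
        by_contra! h'
        have : 0 < y * q - y := by nlinarith
        nlinarith
      nlinarith
  have h3 : y * ((m + 1) * q ^ m) ≤ y * (1 + m * (q ^ m * q)) :=
    mul_le_mul_of_nonneg_left h1 hy.le
  refine le_of_mul_le_mul_left ?_ hm
  nlinarith

/-- Increments of a convex power grow with the base point. -/
theorem rpow_add_sub_rpow_le {P x y h : ℝ} (hP : 1 ≤ P) (hx : 0 ≤ x) (hxy : x ≤ y) (hh : 0 ≤ h) :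
    (x + h) ^ P - x ^ P ≤ (y + h) ^ P - y ^ P := by
  rcases hh.eq_or_lt with rfl | hh
  · simp
  have hd : 0 < y + h - x := by linarith
  have hc := convexOn_rpow hP
  have hx' : x ∈ Set.Ici (0 : ℝ) := hx
  have hy' : y + h ∈ Set.Ici (0 : ℝ) := by simp only [Set.mem_Ici]; linarith
  -- Both `x + h` and `y` are convex combinations of `x` and `y + h`, with the two weights
  -- exchanged. Adding the two convexity bounds gives the claim.
  have ha : 0 ≤ (y - x) / (y + h - x) := div_nonneg (by linarith) hd.le
  have hb : 0 ≤ h / (y + h - x) := by positivity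
  have e1 := hc.2 hx' hy' ha hb (by field_simp; ring)
  have e2 := hc.2 hx' hy' hb ha (by field_simp; ring)
  simp only [smul_eq_mul] at e1 e2
  rw [show (y - x) / (y + h - x) * x + h / (y + h - x) * (y + h) = x + h by field_simp; ring] at e1
  rw [show h / (y + h - x) * x + (y - x) / (y + h - x) * (y + h) = y by field_simp; ring] at e2
  have e3 : (y - x) / (y + h - x) + h / (y + h - x) = 1 := by field_simp; ring
  have e4 : (y - x) / (y + h - x) = 1 - h / (y + h - x) := by linarith
  rw [e4] at e1 e2
  nlinarith

/-- The constant `c` separates the normalized increments of the real one-step problem. -/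
structure Separates (p t c : ℝ) : Prop where
  pos : 0 < c
  ascent : ∀ u, t < u → (u - t) ^ (p - 1) ≤ c * (u ^ p - 1)
  descent : ∀ u, 0 ≤ u → u < 1 → c * (1 - u ^ p) ≤ (t - u) ^ (p - 1)

theorem Separates.one_sub_le {p t c : ℝ} (H : Separates p t c) (hp : 1 < p) (ht : 1 < t)
    {r D : ℝ} (hr : 0 ≤ r) (hD : 0 ≤ D) (h : t - r ≤ D) :
    c * (1 - r ^ p) ≤ D ^ (p - 1) := by
  rcases lt_or_ge r 1 with h1 | h1
  · exact (H.descent r hr h1).trans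
      (Real.rpow_le_rpow (by linarith) h (by linarith))
  · have := Real.one_le_rpow h1 (by linarith : 0 ≤ p)
    have := Real.rpow_nonneg hD (p - 1)
    nlinarith [H.pos]

/-- Here D, s, r stand for `|y - t x| / |x|`, `⟨y - t x, x⟩ / |x| ^ 2` and `|y| / |x|`. With D
fixed, `r ^ 2` is affine in s and `r ^ p` is concave in s because p / 2 < 1. The inequality thus
follows from the collinear cases s = D and s = -D, which are real. -/
theorem Separates.scalar_of_lt_two {p t c : ℝ} (H : Separates p t c) (hp : 1 < p) (hp2 : p < 2)
    (ht : 1 < t) {D s r : ℝ} (hD : 0 < D) (hs : |s| ≤ D) (hr : 0 ≤ r)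
    (h : r ^ 2 = D ^ 2 + 2 * t * s + t ^ 2) :
    D ^ (p - 2) * s ≤ c * (r ^ p - 1) := by
  obtain ⟨hs1, hs2⟩ := abs_le.1 hs
  have hsq : ∀ x : ℝ, 0 ≤ x → (x ^ 2) ^ (p / 2) = x ^ p := fun x hx => by
    rw [← Real.rpow_natCast, ← Real.rpow_mul hx]; congr 1; push_cast; ring
  have ha : -1 ≤ s / D := by rw [le_div_iff₀ hD]; linarith
  have hb : s / D ≤ 1 := by rw [div_le_iff₀ hD]; linarith
  have hc := (Real.concaveOn_rpow (p := p / 2) (by linarith) (by linarith)).2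
    (Set.mem_Ici.2 (sq_nonneg (t + D)))
    (Set.mem_Ici.2 (sq_nonneg |t - D|))
    (show 0 ≤ (1 + s / D) / 2 by linarith) (show 0 ≤ (1 - s / D) / 2 by linarith) (by ring)
  simp only [smul_eq_mul] at hc
  have e : (1 + s / D) / 2 * (t + D) ^ 2 + (1 - s / D) / 2 * |t - D| ^ 2 = r ^ 2 := by
    rw [sq_abs, h]; field_simp; ring
  rw [e, hsq r hr, hsq (t + D) (by linarith), hsq _ (abs_nonneg _)] at hc
  have h1 := H.ascent (t + D) (by linarith)
  rw [add_sub_cancel_left] at h1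
  have h2 := H.one_sub_le hp ht (abs_nonneg (t - D)) hD.le (by linarith [le_abs_self (t - D)])
  have e2 : D ^ (p - 2) * s = D ^ (p - 1) * (s / D) := by
    rw [show p - 1 = p - 2 + 1 by ring, Real.rpow_add_one hD.ne']; field_simp
  rw [e2]
  have h3 := mul_le_mul_of_nonneg_left hc H.pos.le
  have h4 := mul_le_mul_of_nonneg_left h1 (by linarith : 0 ≤ (1 + s / D) / 2)
  have h5 := mul_le_mul_of_nonneg_left h2 (by linarith : 0 ≤ (1 - s / D) / 2)
  nlinarith

/-- Concavity in s fails for p > 2, so r is fixed instead and `D ^ (p - 2) * s` is maximized over D.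
For r ≤ t or r ≥ (p - 1) t the collinear configuration settles the bound. In between the maximum is
interior, and it is compared with the real inequality at the single ratio (p - 1) t. -/
theorem Separates.scalar_of_two_lt {p t c : ℝ} (H : Separates p t c) (hp2 : 2 < p)
    (ht : 1 < t) {D s r : ℝ} (hD : 0 < D) (hs : |s| ≤ D) (hr : 0 ≤ r)
    (h : r ^ 2 = D ^ 2 + 2 * t * s + t ^ 2) :
    D ^ (p - 2) * s ≤ c * (r ^ p - 1) := by
  obtain ⟨hs1, hs2⟩ := abs_le.1 hs
  have hrD : r ≤ D + t := abs_le_of_sq_le_sq' (by nlinarith) (by linarith) |>.2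
  have hDr : |D - t| ≤ r := abs_le_of_sq_le_sq (by nlinarith) hr
  obtain ⟨hD1, hD2⟩ := abs_le.1 hDr
  have hsplit : ∀ x : ℝ, 0 < x → x ^ (p - 1) = x ^ (p - 2) * x := fun x hx => by
    rw [← Real.rpow_add_one hx.ne']; congr 1; ring
  rcases le_or_gt r t with hrt | hrt
  · have h1 := H.one_sub_le (by linarith) ht hr (D := t - r) (by linarith) le_rfl
    rcases hrt.eq_or_lt with rfl | hrt
    · have : s ≤ 0 := by nlinarith
      have := Real.rpow_nonneg hD.le (p - 2)
      have := Real.one_le_rpow ht.le (by linarith : 0 ≤ p)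
      nlinarith [H.pos, mul_nonneg H.pos.le (by linarith : 0 ≤ r ^ p - 1)]
    have h2 : (t - r) ^ (p - 2) ≤ D ^ (p - 2) :=
      Real.rpow_le_rpow (by linarith) (by linarith) (by linarith)
    rw [hsplit _ (by linarith)] at h1
    have h3 : t - r ≤ -s := by nlinarith
    have := mul_le_mul h2 h3 (by linarith) (by positivity)
    nlinarith
  · have hm : 0 < (p - 2) / 2 := by linarith
    have hsq : ∀ x : ℝ, 0 ≤ x → (x ^ 2) ^ ((p - 2) / 2) = x ^ (p - 2) := fun x hx => by
      rw [← Real.rpow_natCast, ← Real.rpow_mul hx]; congr 1; push_cast; ring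
    have hsq' : ∀ x : ℝ, 0 ≤ x → (x ^ 2) ^ (p / 2) = x ^ p := fun x hx => by
      rw [← Real.rpow_natCast, ← Real.rpow_mul hx]; congr 1; push_cast; ring
    suffices D ^ (p - 2) * ((r ^ 2 - t ^ 2) - D ^ 2) ≤ 2 * t * (c * (r ^ p - 1)) by
      rw [show (r ^ 2 - t ^ 2) - D ^ 2 = 2 * t * s by linarith] at this
      refine le_of_mul_le_mul_left ?_ (by linarith : 0 < 2 * t)
      linarith
    rcases le_or_gt ((p - 1) * t) r with hrp | hrp
    -- In the variable `D ^ 2` the vertex is `(p - 2) / p * (r ^ 2 - t ^ 2)`. It is at most the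
    -- endpoint `(r - t) ^ 2` exactly when r ≥ (p - 1) t.
    · have h1 := rpow_mul_sub_le hm (y := (r - t) ^ 2) (x := D ^ 2) (a := r ^ 2 - t ^ 2)
        (by nlinarith) (by positivity) (by
          refine mul_nonneg ?_ (by nlinarith)
          nlinarith [mul_nonneg (by linarith : 0 ≤ r - t) (by linarith : 0 ≤ r - (p - 1) * t)])
      rw [hsq D hD.le, hsq (r - t) (by linarith)] at h1
      have h2 := H.ascent r hrt
      rw [hsplit _ (by linarith)] at h2
      have h3 := mul_le_mul_of_nonneg_left h2 (by linarith : 0 ≤ 2 * t)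
      nlinarith
    · set r₀ := (p - 1) * t with hr₀
      -- Since `r₀ ^ 2 - t ^ 2 = p (p - 2) t ^ 2`, μ is the quotient of `r ^ 2 - t ^ 2` by its value
      -- at r₀. The interior maximum scales as `μ ^ (p / 2)`, so it remains to show `μ ^ (p / 2) *
      -- (r₀ ^ p - 1) ≤ r ^ p - 1`.
      set μ := (r ^ 2 - t ^ 2) / (p * (p - 2) * t ^ 2) with hμ
      have hp20 : 0 < p - 2 := by linarith
      have hA0 : 0 < p * (p - 2) * t ^ 2 := by positivity
      have hμ0 : 0 < μ := div_pos (by nlinarith) hA0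
      have hAμ : r ^ 2 - t ^ 2 = μ * (p * (p - 2) * t ^ 2) := by rw [hμ]; field_simp
      have hμ1 : μ ≤ 1 := by
        rw [hμ, div_le_one hA0]
        nlinarith
      have hx00 : 0 < (p - 2) * t := mul_pos (by linarith) (by linarith)
      have h1 := rpow_mul_sub_le hm (y := μ * ((p - 2) * t) ^ 2) (x := D ^ 2) (a := r ^ 2 - t ^ 2)
        (by positivity) (by positivity) (by
          rw [hAμ, show ((p - 2) / 2 + 1) * (μ * ((p - 2) * t) ^ 2) -
            (p - 2) / 2 * (μ * (p * (p - 2) * t ^ 2)) = 0 by ring]; simp)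
      rw [hsq D hD.le, Real.mul_rpow hμ0.le (sq_nonneg _), hsq _ hx00.le] at h1
      have h2 := H.ascent r₀ (by linarith)
      rw [show r₀ - t = (p - 2) * t by rw [hr₀]; ring, hsplit _ hx00] at h2
      have hr1 : 1 ≤ r₀ := by linarith
      have hr2 : 0 ≤ r₀ ^ 2 - 1 := by nlinarith
      have h3 := rpow_add_sub_rpow_le (P := p / 2) (x := μ) (y := μ * r₀ ^ 2) (h := 1 - μ)
        (by linarith) hμ0.le (by linarith [mul_nonneg hμ0.le hr2]) (by linarith)
      rw [add_sub_cancel, Real.one_rpow, Real.mul_rpow hμ0.le (sq_nonneg r₀),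
        hsq' r₀ (by linarith)] at h3
      have h4 : (μ * r₀ ^ 2 + (1 - μ)) ^ (p / 2) ≤ r ^ p := by
        rw [← hsq' r hr]
        refine Real.rpow_le_rpow (by linarith [mul_nonneg hμ0.le hr2]) ?_ (by linarith)
        have : r ^ 2 = μ * r₀ ^ 2 + (1 - μ) * t ^ 2 := by rw [hr₀]; linear_combination hAμ
        linarith [mul_nonneg (by linarith : 0 ≤ 1 - μ) (by nlinarith : 0 ≤ t ^ 2 - 1)]
      have e : μ ^ (p / 2) = μ ^ ((p - 2) / 2) * μ := by
        rw [← Real.rpow_add_one hμ0.ne']; congr 1; ring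
      have h5 : μ ^ (p / 2) * (r₀ ^ p - 1) ≤ r ^ p - 1 := by linarith
      calc D ^ (p - 2) * ((r ^ 2 - t ^ 2) - D ^ 2) ≤ _ := h1
        _ = 2 * t * (μ ^ (p / 2) * (((p - 2) * t) ^ (p - 2) * ((p - 2) * t))) := by
          rw [e, hAμ]; ring
        _ ≤ 2 * t * (μ ^ (p / 2) * (c * (r₀ ^ p - 1))) := by gcongr
        _ = 2 * t * (c * (μ ^ (p / 2) * (r₀ ^ p - 1))) := by ring
        _ ≤ _ := by have := H.pos; gcongr

/-- The one-step inequality whose telescoped form bounds the extremal functional. -/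
theorem Separates.inner_le {p t c : ℝ} (H : Separates p t c) (hp : 1 < p) (hp2 : p ≠ 2)
    (ht : 1 < t) (x y : ℂ) :
    ‖y - t * x‖ ^ (p - 2) * inner ℝ (y - t * x) x ≤ c * (‖y‖ ^ p - ‖x‖ ^ p) := by
  have hp0 : p ≠ 0 := by linarith
  rcases eq_or_ne x 0 with rfl | hx
  · simp [Real.zero_rpow hp0]
    have := H.pos
    positivity
  rcases eq_or_ne (y - t * x) 0 with hz | hz
  · rw [hz]
    simp only [inner_zero_left, mul_zero]
    have : ‖y‖ = t * ‖x‖ := by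
      rw [sub_eq_zero.1 hz]; simp [abs_of_pos (by linarith : 0 < t)]
    refine mul_nonneg H.pos.le (sub_nonneg.2 (Real.rpow_le_rpow (norm_nonneg _) ?_ (by linarith)))
    rw [this]; nlinarith [norm_nonneg x]
  have hX : 0 < ‖x‖ := norm_pos_iff.2 hx
  have hD : 0 < ‖y - t * x‖ := norm_pos_iff.2 hz
  set s := inner ℝ (y - t * x) x with hs
  have hsb : |s| ≤ ‖y - t * x‖ * ‖x‖ := abs_real_inner_le_norm _ _
  have hY : ‖y‖ ^ 2 = ‖y - t * x‖ ^ 2 + 2 * t * s + t ^ 2 * ‖x‖ ^ 2 := by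
    have h0 : y = (y - t * x) + t • x := by simp
    have h1 := norm_add_sq_real (y - t * x) (t • x)
    rw [← h0, inner_smul_right, norm_smul, Real.norm_eq_abs, mul_pow, sq_abs] at h1
    rw [h1]; ring
  have key : (‖y - t * x‖ / ‖x‖) ^ (p - 2) * (s / ‖x‖ ^ 2) ≤ c * ((‖y‖ / ‖x‖) ^ p - 1) := by
    have a1 : |s / ‖x‖ ^ 2| ≤ ‖y - t * x‖ / ‖x‖ := by
      rw [abs_div, abs_of_pos (by positivity : 0 < ‖x‖ ^ 2), div_le_div_iff₀ (by positivity) hX]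
      nlinarith
    have a2 : (‖y‖ / ‖x‖) ^ 2 =
        (‖y - t * x‖ / ‖x‖) ^ 2 + 2 * t * (s / ‖x‖ ^ 2) + t ^ 2 := by
      rw [div_pow, hY]; field_simp
    rcases lt_or_gt_of_ne hp2 with h | h
    · exact H.scalar_of_lt_two hp h ht (by positivity) a1 (by positivity) a2
    · exact H.scalar_of_two_lt h ht (by positivity) a1 (by positivity) a2
  rw [Real.div_rpow hD.le hX.le, Real.div_rpow (norm_nonneg _) hX.le] at key
  have e : ‖x‖ ^ p = ‖x‖ ^ (p - 2) * ‖x‖ ^ 2 := by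
    rw [← Real.rpow_natCast, ← Real.rpow_add hX]; congr 1; push_cast; ring
  have hXp : 0 < ‖x‖ ^ p := by positivity
  have := mul_le_mul_of_nonneg_left key hXp.le
  calc _ = ‖x‖ ^ p * (‖y - t * x‖ ^ (p - 2) / ‖x‖ ^ (p - 2) * (s / ‖x‖ ^ 2)) := by
        rw [e]; field_simp
    _ ≤ _ := this
    _ = _ := by field_simp

end EllPA

/-! ### Characteristic roots as extremal points of the two ratios. -/

noncomputable section

namespace EllPA

open Set

/-- The normalized increment of the real one-step problem below `1`. -/
def descentRatio (p t u : ℝ) : ℝ := (t - u) ^ (p - 1) / (1 - u ^ p)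

/-- The normalized increment of the real one-step problem above `t`. -/
def ascentRatio (p t u : ℝ) : ℝ := (u - t) ^ (p - 1) / (u ^ p - 1)

/-- The characteristic equation of the constant-ratio solutions, divided by `x ^ (p - 1)`. -/
def charFun (p t x : ℝ) : ℝ := p * t - x - (p - 1) * x ^ (1 - p)

theorem rpow_mul_charFun {p t x : ℝ} (hx : 0 < x) :
    x ^ (p - 1) * charFun p t x = x ^ (p - 1) * (p * t - x) - (p - 1) := by
  have : x ^ (p - 1) * x ^ (1 - p) = 1 := by
    rw [← Real.rpow_add hx]; simp
  rw [charFun]; linear_combination -(p - 1) * this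

theorem charFun_eq_zero_iff {p t x : ℝ} (hx : 0 < x) :
    charFun p t x = 0 ↔ x ^ (p - 1) * (p * t - x) = p - 1 := by
  rw [← sub_eq_zero (b := p - 1), ← rpow_mul_charFun hx]
  simp [(Real.rpow_pos_of_pos hx _).ne']

theorem hasDerivAt_charFun {p t x : ℝ} (hx : 0 < x) :
    HasDerivAt (charFun p t) (-1 + (p - 1) ^ 2 * x ^ (-p)) x := by
  have h := ((hasDerivAt_id x).const_sub (p * t)).sub
    ((Real.hasDerivAt_rpow_const (p := 1 - p) (Or.inl hx.ne')).const_mul (p - 1))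
  refine h.congr_deriv ?_
  rw [show 1 - p - 1 = -p by ring]; ring

/-- Division by `x ^ (p - 1)` pays off here: the undivided function is convex near 0 when p > 2.
Concavity yields at most two roots and the sign pattern negative, positive, negative. -/
theorem strictConcaveOn_charFun {p t : ℝ} (hp : 1 < p) :
    StrictConcaveOn ℝ (Ioi 0) (charFun p t) := by
  refine StrictAntiOn.strictConcaveOn_of_deriv (convex_Ioi 0)
    (fun x hx => (hasDerivAt_charFun hx).continuousAt.continuousWithinAt) ?_
  rw [interior_Ioi]
  intro x hx y hy hxy
  rw [(hasDerivAt_charFun hx).deriv, (hasDerivAt_charFun hy).deriv]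
  have := Real.rpow_lt_rpow_of_neg hx hxy (by linarith : -p < 0)
  have : 0 < (p - 1) ^ 2 := by nlinarith
  nlinarith

theorem charFun_pos {p t x₁ x₂ u : ℝ} (hp : 1 < p) (h1 : 0 < x₁) (e1 : charFun p t x₁ = 0)
    (e2 : charFun p t x₂ = 0) (hu1 : x₁ < u) (hu2 : u < x₂) : 0 < charFun p t u := by
  have := (strictConcaveOn_charFun (t := t) hp).slope_anti_adjacent (mem_Ioi.2 h1)
    (mem_Ioi.2 (by linarith)) hu1 hu2
  rw [e1, e2, div_lt_div_iff₀ (by linarith) (by linarith)] at this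
  nlinarith

theorem charFun_neg_of_lt {p t x₁ x₂ u : ℝ} (hp : 1 < p) (h0 : 0 < u) (h12 : x₁ < x₂)
    (e1 : charFun p t x₁ = 0) (e2 : charFun p t x₂ = 0) (hu : u < x₁) : charFun p t u < 0 := by
  have := (strictConcaveOn_charFun (t := t) hp).slope_anti_adjacent (mem_Ioi.2 h0)
    (mem_Ioi.2 (by linarith)) hu h12
  rw [e1, e2, div_lt_div_iff₀ (by linarith) (by linarith)] at this
  nlinarith

theorem charFun_neg_of_gt {p t x₁ x₂ u : ℝ} (hp : 1 < p) (h1 : 0 < x₁) (h12 : x₁ < x₂)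
    (e1 : charFun p t x₁ = 0) (e2 : charFun p t x₂ = 0) (hu : x₂ < u) : charFun p t u < 0 := by
  have := (strictConcaveOn_charFun (t := t) hp).slope_anti_adjacent (mem_Ioi.2 h1)
    (mem_Ioi.2 (by linarith)) h12 hu
  rw [e1, e2, div_lt_div_iff₀ (by linarith) (by linarith)] at this
  nlinarith

/-- `x ^ (p - 1) * (p t - x)` vanishes at 0 and p t, and exceeds p - 1 at 1 and t. The location of
the roots matters: each lies in the domain of one ratio. -/
theorem exists_charFun_zeros {p t : ℝ} (hp : 1 < p) (ht : 1 < t) :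
    ∃ x₁ x₂, 0 < x₁ ∧ x₁ < 1 ∧ t < x₂ ∧ charFun p t x₁ = 0 ∧ charFun p t x₂ = 0 := by
  have hcont : Continuous fun x : ℝ => x ^ (p - 1) * (p * t - x) :=
    (Real.continuous_rpow_const (by linarith)).mul (by fun_prop)
  obtain ⟨x₁, ⟨ha, hb⟩, hx₁⟩ := intermediate_value_Ioo zero_le_one hcont.continuousOn
    (show p - 1 ∈ Ioo _ _ from ⟨by simp [Real.zero_rpow (by linarith : p - 1 ≠ 0)]; linarith,
      by simp; nlinarith⟩)
  have htp : t ≤ p * t := by nlinarith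
  have ht1 : 1 < t ^ p := Real.one_lt_rpow ht (by linarith)
  obtain ⟨x₂, ⟨hc, hd⟩, hx₂⟩ := intermediate_value_Ioo' htp hcont.continuousOn
    (show p - 1 ∈ Ioo _ _ from ⟨by simp; linarith, by
      have : t ^ (p - 1) * (p * t - t) = (p - 1) * t ^ p := by
        rw [show p = p - 1 + 1 by ring, Real.rpow_add_one (by linarith)]; ring_nf
      simp only [this]; nlinarith⟩)
  exact ⟨x₁, x₂, ha, hb, hc, (charFun_eq_zero_iff ha).2 hx₁,
    (charFun_eq_zero_iff (by linarith)).2 hx₂⟩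

/-- The derivative is a positive factor times `charFun`, so the critical points are characteristic
roots. The same holds for `descentRatio`. -/
theorem hasDerivAt_ascentRatio {p t u : ℝ} (hp : 1 < p) (ht : 1 < t) (hu : t < u) :
    HasDerivAt (ascentRatio p t)
      ((u - t) ^ (p - 2) * u ^ (p - 1) / (u ^ p - 1) ^ 2 * charFun p t u) u := by
  have hu0 : 0 < u := by linarith
  have hup : 1 < u ^ p := Real.one_lt_rpow (by linarith) (by linarith)
  have h1 := ((hasDerivAt_id u).sub_const t).rpow_const (p := p - 1)
    (Or.inl (sub_pos.2 hu).ne')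
  have h2 := (Real.hasDerivAt_rpow_const (x := u) (p := p) (Or.inl hu0.ne')).sub_const 1
  refine (h1.div h2 (by linarith)).congr_deriv ?_
  have e1 : (u - t) ^ (p - 1) = (u - t) ^ (p - 2) * (u - t) := by
    rw [← Real.rpow_add_one (sub_pos.2 hu).ne']; congr 1; ring
  have e2 : u ^ p = u ^ (p - 1) * u := by
    rw [← Real.rpow_add_one hu0.ne']; congr 1; ring
  have h3 := rpow_mul_charFun (p := p) (t := t) hu0
  simp only [id]
  rw [show p - 1 - 1 = p - 2 by ring, div_mul_eq_mul_div, mul_assoc (_ ^ (p - 2)), h3, e1, e2]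
  congr 1; ring

theorem hasDerivAt_descentRatio {p t u : ℝ} (hp : 1 < p) (ht : 1 < t) (hu0 : 0 < u) (hu : u < 1) :
    HasDerivAt (descentRatio p t)
      ((t - u) ^ (p - 2) * u ^ (p - 1) / (1 - u ^ p) ^ 2 * charFun p t u) u := by
  have hup : u ^ p < 1 := Real.rpow_lt_one hu0.le hu (by linarith)
  have htu : 0 < t - u := by linarith
  have h1 := ((hasDerivAt_id u).const_sub t).rpow_const (p := p - 1) (Or.inl htu.ne')
  have h2 := (Real.hasDerivAt_rpow_const (x := u) (p := p) (Or.inl hu0.ne')).const_sub 1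
  refine (h1.div h2 (by linarith)).congr_deriv ?_
  have e1 : (t - u) ^ (p - 1) = (t - u) ^ (p - 2) * (t - u) := by
    rw [← Real.rpow_add_one htu.ne']; congr 1; ring
  have e2 : u ^ p = u ^ (p - 1) * u := by
    rw [← Real.rpow_add_one hu0.ne']; congr 1; ring
  have h3 := rpow_mul_charFun (p := p) (t := t) hu0
  simp only [id]
  rw [show p - 1 - 1 = p - 2 by ring, div_mul_eq_mul_div, mul_assoc (_ ^ (p - 2)), h3, e1, e2]
  congr 1; ring

theorem continuousOn_descentRatio {p t : ℝ} (hp : 1 < p) :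
    ContinuousOn (descentRatio p t) (Ico 0 1) := by
  refine ContinuousOn.div ?_ ?_ ?_
  · exact ((Real.continuous_rpow_const (by linarith)).comp
      (continuous_const.sub continuous_id)).continuousOn
  · exact (continuous_const.sub (Real.continuous_rpow_const (by linarith))).continuousOn
  · intro u hu
    have := Real.rpow_lt_one hu.1 hu.2 (by linarith : 0 < p)
    linarith

theorem isMinOn_descentRatio {p t x₁ x₂ : ℝ} (hp : 1 < p) (ht : 1 < t) (h0 : 0 < x₁) (h1 : x₁ < 1)
    (h2 : t < x₂) (e1 : charFun p t x₁ = 0) (e2 : charFun p t x₂ = 0) :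
    IsMinOn (descentRatio p t) (Ico 0 1) x₁ := by
  have hpos : ∀ u, 0 < u → u < 1 → 0 < (t - u) ^ (p - 2) * u ^ (p - 1) / (1 - u ^ p) ^ 2 := by
    intro u hu hu1
    have := Real.rpow_lt_one hu.le hu1 (by linarith : 0 < p)
    have : 0 < 1 - u ^ p := by linarith
    have : 0 < t - u := by linarith
    positivity
  intro u hu
  rcases le_total u x₁ with h | h
  · refine antitoneOn_of_deriv_nonpos (convex_Icc 0 x₁)
      ((continuousOn_descentRatio hp).mono fun y hy => ⟨hy.1, by linarith [hy.2]⟩)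
      ?_ ?_ ⟨hu.1, h⟩ ⟨h0.le, le_rfl⟩ h
    all_goals
      rw [interior_Icc]
      intro y hy
      have hd := hasDerivAt_descentRatio hp ht hy.1 (by linarith [hy.2])
    · exact hd.differentiableAt.differentiableWithinAt
    · rw [hd.deriv]
      exact mul_nonpos_of_nonneg_of_nonpos (hpos y hy.1 (by linarith [hy.2])).le
        (charFun_neg_of_lt hp hy.1 (by linarith) e1 e2 hy.2).le
  · refine monotoneOn_of_deriv_nonneg (convex_Ico x₁ 1)
      ((continuousOn_descentRatio hp).mono fun y hy => ⟨by linarith [hy.1], hy.2⟩)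
      ?_ ?_ ⟨le_rfl, h1⟩ ⟨h, hu.2⟩ h
    all_goals
      rw [interior_Ico]
      intro y hy
      have hd := hasDerivAt_descentRatio hp ht (h0.trans hy.1) hy.2
    · exact hd.differentiableAt.differentiableWithinAt
    · rw [hd.deriv]
      exact mul_nonneg (hpos y (h0.trans hy.1) hy.2).le
        (charFun_pos hp h0 e1 e2 hy.1 (by linarith [hy.2])).le

theorem isMaxOn_ascentRatio {p t x₁ x₂ : ℝ} (hp : 1 < p) (ht : 1 < t) (h0 : 0 < x₁) (h1 : x₁ < 1)
    (h2 : t < x₂) (e1 : charFun p t x₁ = 0) (e2 : charFun p t x₂ = 0) :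
    IsMaxOn (ascentRatio p t) (Ioi t) x₂ := by
  have hpos : ∀ u, t < u → 0 < (u - t) ^ (p - 2) * u ^ (p - 1) / (u ^ p - 1) ^ 2 := by
    intro u hu
    have := Real.one_lt_rpow (by linarith : 1 < u) (by linarith : 0 < p)
    have : 0 < u ^ p - 1 := by linarith
    have : 0 < u - t := by linarith
    have : 0 < u := by linarith
    positivity
  intro u hu
  rcases le_total u x₂ with h | h
  · refine monotoneOn_of_deriv_nonneg (convex_Ioc t x₂)
      (fun y hy => (hasDerivAt_ascentRatio hp ht hy.1).continuousAt.continuousWithinAt)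
      ?_ ?_ ⟨hu, h⟩ ⟨h2, le_rfl⟩ h
    all_goals
      rw [interior_Ioc]
      intro y hy
      have hd := hasDerivAt_ascentRatio hp ht hy.1
    · exact hd.differentiableAt.differentiableWithinAt
    · rw [hd.deriv]
      exact mul_nonneg (hpos y hy.1).le (charFun_pos hp h0 e1 e2 (by linarith [hy.1]) hy.2).le
  · refine antitoneOn_of_deriv_nonpos (convex_Ici x₂)
      (fun y hy => (hasDerivAt_ascentRatio hp ht (h2.trans_le hy)).continuousAt.continuousWithinAt)
      ?_ ?_ self_mem_Ici h h
    all_goals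
      rw [interior_Ici]
      intro y hy
      have hd := hasDerivAt_ascentRatio hp ht (h2.trans hy)
    · exact hd.differentiableAt.differentiableWithinAt
    · rw [hd.deriv]
      exact mul_nonpos_of_nonneg_of_nonpos (hpos y (h2.trans hy)).le
        (charFun_neg_of_gt hp h0 (by linarith) e1 e2 hy).le

/-- Multiplying the characteristic equation by x gives `(p t - x) (1 - x ^ p) = p (t - x)`. This
identifies the two sides of the equation for τ with p times the extreme ratios. -/
theorem charValue_eq_descentRatio {p t x : ℝ} (hp : 1 < p) (ht : 1 < t) (h0 : 0 < x) (h1 : x < 1)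
    (e : charFun p t x = 0) :
    (p * t - x) * |x - t| ^ (p - 2) = p * descentRatio p t x := by
  have hx : x ^ p < 1 := Real.rpow_lt_one h0.le h1 (by linarith)
  have htx : 0 < t - x := by linarith
  have e1 : (t - x) ^ (p - 1) = (t - x) ^ (p - 2) * (t - x) := by
    rw [← Real.rpow_add_one htx.ne']; congr 1; ring
  have e2 : x ^ p = x ^ (p - 1) * x := by
    rw [← Real.rpow_add_one h0.ne']; congr 1; ring
  have e3 := (charFun_eq_zero_iff h0).1 e
  rw [descentRatio, abs_sub_comm, abs_of_pos htx, e1, ← mul_div_assoc,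
    eq_div_iff (by linarith), e2]
  linear_combination (-(t - x) ^ (p - 2) * x) * e3

theorem charValue_eq_ascentRatio {p t x : ℝ} (hp : 1 < p) (ht : 1 < t) (h : t < x)
    (e : charFun p t x = 0) :
    (p * t - x) * |x - t| ^ (p - 2) = p * ascentRatio p t x := by
  have h0 : 0 < x := by linarith
  have hx : 1 < x ^ p := Real.one_lt_rpow (by linarith) (by linarith)
  have htx : 0 < x - t := by linarith
  have e1 : (x - t) ^ (p - 1) = (x - t) ^ (p - 2) * (x - t) := by
    rw [← Real.rpow_add_one htx.ne']; congr 1; ring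
  have e2 : x ^ p = x ^ (p - 1) * x := by
    rw [← Real.rpow_add_one h0.ne']; congr 1; ring
  have e3 := (charFun_eq_zero_iff h0).1 e
  rw [ascentRatio, abs_of_pos htx, e1, ← mul_div_assoc, eq_div_iff (by linarith), e2]
  linear_combination ((x - t) ^ (p - 2) * x) * e3

theorem setOf_charEq {p t x₁ x₂ : ℝ} (hp : 1 < p) (h0 : 0 < x₁) (h12 : x₁ < x₂)
    (e1 : charFun p t x₁ = 0) (e2 : charFun p t x₂ = 0) :
    {x : ℝ | 0 < x ∧ x ^ (p - 1) * (p * t - x) = p - 1} = {x₁, x₂} := by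
  ext x
  simp only [mem_ofPred_eq, mem_insert_iff, mem_singleton_iff]
  constructor
  · rintro ⟨hx, h⟩
    rw [← charFun_eq_zero_iff hx] at h
    by_contra! hne
    rcases lt_or_gt_of_ne hne.1 with h' | h'
    · exact (charFun_neg_of_lt hp hx h12 e1 e2 h').ne h
    rcases lt_or_gt_of_ne hne.2 with h'' | h''
    · exact (charFun_pos hp h0 e1 e2 h' h'').ne' h
    · exact (charFun_neg_of_gt hp h0 h12 e1 e2 h'').ne h
  · rintro (rfl | rfl)
    · exact ⟨h0, (charFun_eq_zero_iff h0).1 e1⟩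
    · exact ⟨by linarith, (charFun_eq_zero_iff (by linarith)).1 e2⟩

end EllPA

end

/-! ### Dependence on t and the threshold. -/

namespace EllPA

open Set Filter Topology

theorem descentRatio_lt {p t t' u : ℝ} (hp : 1 < p) (ht : 1 < t) (htt : t < t')
    (hu : u ∈ Ico (0 : ℝ) 1) : descentRatio p t u < descentRatio p t' u := by
  have := Real.rpow_lt_one hu.1 hu.2 (by linarith : 0 < p)
  exact div_lt_div_of_pos_right (Real.rpow_lt_rpow (by linarith [hu.2]) (by linarith)
    (by linarith)) (by linarith)

/-- `(t - u) / (t - 1)` decreases in t. This limits how fast the minimum can grow, so its continuity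
needs no study of how the roots move. -/
theorem descentRatio_div_le {p t t' u : ℝ} (hp : 1 < p) (ht : 1 < t) (htt : t ≤ t')
    (hu : u ∈ Ico (0 : ℝ) 1) :
    descentRatio p t' u / (t' - 1) ^ (p - 1) ≤ descentRatio p t u / (t - 1) ^ (p - 1) := by
  have := Real.rpow_lt_one hu.1 hu.2 (by linarith : 0 < p)
  have hu1 := hu.2
  rw [descentRatio, descentRatio, div_right_comm, div_right_comm ((t - u) ^ _),
    ← Real.div_rpow (by linarith) (by linarith), ← Real.div_rpow (by linarith) (by linarith)]
  refine div_le_div_of_nonneg_right (Real.rpow_le_rpow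
    (div_nonneg (by linarith) (by linarith)) ?_ (by linarith)) (by linarith)
  rw [div_le_div_iff₀ (by linarith) (by linarith)]
  nlinarith

theorem ascentRatio_pos {p t u : ℝ} (hp : 1 < p) (ht : 1 < t) (hu : t < u) :
    0 < ascentRatio p t u := by
  have := Real.one_lt_rpow (by linarith : 1 < u) (by linarith : 0 < p)
  exact div_pos (Real.rpow_pos_of_pos (by linarith) _) (by linarith)

theorem ascentRatio_lt {p t t' u : ℝ} (hp : 1 < p) (ht : 1 < t) (htt : t < t')
    (hu : t' < u) : ascentRatio p t' u < ascentRatio p t u := by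
  have := Real.one_lt_rpow (by linarith : 1 < u) (by linarith : 0 < p)
  exact div_lt_div_of_pos_right (Real.rpow_lt_rpow (by linarith) (by linarith)
    (by linarith)) (by linarith)

/-- Scaling u along with t keeps `u / t` fixed, and only the -1 in the denominators changes. This
limits how fast the maximum can fall. -/
theorem ascentRatio_mul_le {p t t' u : ℝ} (hp : 1 < p) (ht : 1 < t) (htt : t ≤ t')
    (hu : t < u) :
    ascentRatio p t u * ((t ^ p - 1) / t ^ (p - 1)) ≤
      ascentRatio p t' (t' / t * u) * ((t' ^ p - 1) / t' ^ (p - 1)) := by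
  set l := t' / t with hl
  have ht0 : 0 < t := by linarith
  have hl1 : 1 ≤ l := by rw [hl, one_le_div ht0]; exact htt
  have htl : t' = l * t := by rw [hl]; field_simp
  have hu1 := Real.one_lt_rpow (by linarith : 1 < u) (by linarith : 0 < p)
  have ht1 := Real.one_lt_rpow ht (by linarith : 0 < p)
  have hlp := Real.one_le_rpow hl1 (by linarith : 0 ≤ p)
  have htu := Real.rpow_lt_rpow ht0.le hu (by linarith : 0 < p)
  have hl0 : 0 < l ^ (p - 1) := Real.rpow_pos_of_pos (by linarith) _
  have htp : 0 < t ^ (p - 1) := Real.rpow_pos_of_pos ht0 _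
  have hut : 0 < (u - t) ^ (p - 1) := Real.rpow_pos_of_pos (by linarith) _
  rw [ascentRatio, ascentRatio, htl, ← mul_sub, Real.mul_rpow (by linarith) (by linarith),
    Real.mul_rpow (by linarith) (by linarith), Real.mul_rpow (by linarith) (by linarith),
    Real.mul_rpow (by linarith) (by linarith)]
  have e : l ^ (p - 1) * (u - t) ^ (p - 1) / (l ^ p * u ^ p - 1) *
      ((l ^ p * t ^ p - 1) / (l ^ (p - 1) * t ^ (p - 1))) =
      (u - t) ^ (p - 1) / t ^ (p - 1) * ((l ^ p * t ^ p - 1) / (l ^ p * u ^ p - 1)) := by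
    field_simp
  rw [e, show (u - t) ^ (p - 1) / (u ^ p - 1) * ((t ^ p - 1) / t ^ (p - 1)) =
    (u - t) ^ (p - 1) / t ^ (p - 1) * ((t ^ p - 1) / (u ^ p - 1)) by ring]
  refine mul_le_mul_of_nonneg_left ?_ (by positivity)
  rw [div_le_div_iff₀ (by linarith) (by nlinarith)]
  nlinarith [mul_nonneg (by linarith : 0 ≤ l ^ p - 1) (by linarith : 0 ≤ u ^ p - t ^ p)]

/-- A nonnegative monotone function whose quotient by a continuous one is antitone is
continuous. -/
theorem continuousOn_of_monotoneOn_of_antitoneOn_div {f g : ℝ → ℝ} {s : Set ℝ}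
    (hf0 : ∀ x ∈ s, 0 ≤ f x) (hf : MonotoneOn f s) (hfg : AntitoneOn (fun x => f x / g x) s)
    (hg0 : ∀ x ∈ s, 0 < g x) (hg : ContinuousOn g s) : ContinuousOn f s := by
  intro t ht
  have h1 : Tendsto (fun x => f t * |g x / g t - 1|) (𝓝[s] t) (𝓝 0) := by
    have h := (((hg t ht).tendsto.div_const (g t)).sub_const 1).abs.const_mul (f t)
    rwa [div_self (hg0 t ht).ne', sub_self, abs_zero, mul_zero] at h
  refine tendsto_iff_norm_sub_tendsto_zero.2 (squeeze_zero' (Eventually.of_forall fun _ =>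
    norm_nonneg _) ?_ h1)
  filter_upwards [self_mem_nhdsWithin] with x hx
  have hx0 := hg0 x hx
  have ht0 := hg0 t ht
  -- The values `f x` and `f t * (g x / g t)` lie on the same side of `f t`, the former closer to
  -- it.
  have e : f t * (g x / g t) = f t / g t * g x := by ring
  rw [Real.norm_eq_abs, ← abs_of_nonneg (hf0 t ht), ← abs_mul, abs_of_nonneg (hf0 t ht)]
  rcases le_total t x with h | h
  · have a := hf ht hx h
    have b := hfg ht hx h
    simp only at b
    rw [div_le_iff₀ hx0] at b
    exact abs_le_abs_of_nonneg (by linarith) (by linarith)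
  · have a := hf hx ht h
    have b := hfg hx ht h
    simp only at b
    rw [le_div_iff₀ hx0] at b
    rw [abs_sub_comm]
    rw [← abs_neg (_ * _)]
    exact abs_le_abs_of_nonneg (by linarith) (by linarith)

theorem exists_rpow_lt {q δ : ℝ} (hq : 0 < q) (hδ : 0 < δ) :
    ∃ ε : ℝ, 0 < ε ∧ ε < 1 / 2 ∧ ε ^ q < δ := by
  have h1 : Tendsto (fun x : ℝ => x ^ q) (𝓝[>] 0) (𝓝 0) := by
    have := (Real.continuousAt_rpow_const 0 q (Or.inr hq.le)).tendsto
    rw [Real.zero_rpow hq.ne'] at this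
    exact this.mono_left nhdsWithin_le_nhds
  obtain ⟨ε, h2, h3⟩ := ((h1.eventually (gt_mem_nhds hδ)).and
    (Ioo_mem_nhdsGT (by norm_num : (0 : ℝ) < 1 / 2))).exists
  exact ⟨ε, h3.1, h3.2, h2⟩

/-- Just above `t = 1` the two normalized increments are in strict order. -/
theorem exists_descentRatio_lt_ascentRatio {p : ℝ} (hp : 1 < p) (hp2 : p ≠ 2) :
    ∃ t u v, 1 < t ∧ t < 2 ∧ u ∈ Ico (0 : ℝ) 1 ∧ t < v ∧
      descentRatio p t u < ascentRatio p t v := by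
  rcases lt_or_gt_of_ne hp2 with h | h
  -- For p < 2 the ascent ratio at v = 1 + 2ε is at least `ε ^ (p - 2) / 8`, which blows up, while
  -- the descent ratio at 0 stays at most 2.
  · obtain ⟨ε, h0, h1, h2⟩ := exists_rpow_lt (q := 2 - p) (δ := 1 / 16) (by linarith)
      (by norm_num)
    refine ⟨1 + ε, 0, 1 + 2 * ε, by linarith, by linarith, by simp, by linarith, ?_⟩
    have hu : (1 + 2 * ε) ^ p ≤ 1 + 8 * ε := by
      calc (1 + 2 * ε) ^ p ≤ (1 + 2 * ε) ^ (2 : ℝ) :=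
            Real.rpow_le_rpow_of_exponent_le (by linarith) h.le
        _ = (1 + 2 * ε) ^ 2 := by norm_cast
        _ ≤ _ := by nlinarith
    have hu1 := Real.one_lt_rpow (by linarith : 1 < 1 + 2 * ε) (by linarith : 0 < p)
    have hA : descentRatio p (1 + ε) 0 ≤ 2 := by
      rw [descentRatio, Real.zero_rpow (by linarith)]
      simp only [sub_zero, div_one]
      calc (1 + ε) ^ (p - 1) ≤ (1 + ε) ^ (1 : ℝ) :=
            Real.rpow_le_rpow_of_exponent_le (by linarith) (by linarith)
        _ ≤ 2 := by rw [Real.rpow_one]; linarith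
    refine hA.trans_lt ?_
    rw [ascentRatio, lt_div_iff₀ (by linarith), show 1 + 2 * ε - (1 + ε) = ε by ring]
    have e : ε ^ (2 - p) * ε ^ (p - 1) = ε := by
      rw [← Real.rpow_add h0]; norm_num
    have := Real.rpow_pos_of_pos h0 (p - 1)
    nlinarith
  -- For p > 2 the descent ratio at u = 1 - ε is at most `2 ^ (p - 1) * ε ^ (p - 2)`, which tends to
  -- 0, while the ascent ratio at 2 stays bounded below.
  · have hK : 0 < (1 / 2 : ℝ) ^ (p - 1) / (2 ^ p - 1) := by
      have := Real.one_lt_rpow one_lt_two (by linarith : 0 < p)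
      have : (0 : ℝ) < 2 ^ p - 1 := by linarith
      positivity
    obtain ⟨ε, h0, h1, h2⟩ := exists_rpow_lt (q := p - 2)
      (δ := (1 / 2 : ℝ) ^ (p - 1) / (2 ^ p - 1) / 2 ^ (p - 1)) (by linarith) (by positivity)
    refine ⟨1 + ε, 1 - ε, 2, by linarith, by linarith, ⟨by linarith, by linarith⟩,
      by linarith, ?_⟩
    have hu : (1 - ε) ^ p ≤ 1 - ε := by
      have := Real.rpow_le_rpow_of_exponent_ge (by linarith : 0 < 1 - ε) (by linarith) hp.le
      rwa [Real.rpow_one] at this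
    have h2p := Real.one_lt_rpow one_lt_two (by linarith : 0 < p)
    calc descentRatio p (1 + ε) (1 - ε) ≤ (2 * ε) ^ (p - 1) / ε := by
          rw [descentRatio, show 1 + ε - (1 - ε) = 2 * ε by ring]
          exact div_le_div_of_nonneg_left (by positivity) h0 (by linarith)
      _ = ε ^ (p - 2) * 2 ^ (p - 1) := by
          rw [Real.mul_rpow (by norm_num) h0.le, show p - 1 = p - 2 + 1 by ring,
            Real.rpow_add_one h0.ne']
          field_simp
      _ < (1 / 2 : ℝ) ^ (p - 1) / (2 ^ p - 1) := by
          rwa [lt_div_iff₀ (by positivity)] at h2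
      _ ≤ _ := by
          rw [ascentRatio]
          exact div_le_div_of_nonneg_right (Real.rpow_le_rpow (by norm_num) (by linarith)
            (by linarith)) (by linarith)

/-- The parameter at which the extreme normalized increments agree. -/
theorem exists_threshold {p : ℝ} (hp : 1 < p) (hp2 : p ≠ 2) {A B : ℝ → ℝ}
    (hA : ∀ t, 1 < t → IsLeast (descentRatio p t '' Ico 0 1) (A t))
    (hB : ∀ t, 1 < t → IsGreatest (ascentRatio p t '' Ioi t) (B t)) :
    ∃ τ, 1 < τ ∧ A τ = B τ ∧ (∀ t, 1 < t → t < τ → A t < B t) ∧ ∀ t, τ < t → B t < A t := by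
  have hAm : StrictMonoOn A (Ioi 1) := by
    intro t ht t' ht' htt
    obtain ⟨u, hu, hu'⟩ := (hA t' ht').1
    rw [← hu']
    exact ((hA t ht).2 (mem_image_of_mem _ hu)).trans_lt (descentRatio_lt hp ht htt hu)
  have hBm : StrictAntiOn B (Ioi 1) := by
    intro t ht t' ht' htt
    obtain ⟨u, hu, hu'⟩ := (hB t' ht').1
    rw [← hu']
    exact (ascentRatio_lt hp ht htt hu).trans_le ((hB t ht).2 (mem_image_of_mem _ (htt.trans hu)))
  have hA0 : ∀ t ∈ Ioi (1 : ℝ), 0 ≤ A t := by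
    intro t ht
    obtain ⟨u, hu, hu'⟩ := (hA t ht).1
    rw [← hu']
    have := Real.rpow_lt_one hu.1 hu.2 (by linarith : 0 < p)
    exact div_nonneg (Real.rpow_nonneg (by linarith [hu.2, mem_Ioi.1 ht]) _) (by linarith)
  have hB0 : ∀ t ∈ Ioi (1 : ℝ), 0 < B t := by
    intro t ht
    obtain ⟨u, hu, hu'⟩ := (hB t ht).1
    rw [← hu']
    exact ascentRatio_pos hp ht hu
  have hAc : ContinuousOn A (Ioi 1) := by
    refine continuousOn_of_monotoneOn_of_antitoneOn_div (g := fun t => (t - 1) ^ (p - 1)) hA0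
      hAm.monotoneOn ?_ (fun t ht => Real.rpow_pos_of_pos (sub_pos.2 ht) _) ?_
    · intro t ht t' ht' htt
      obtain ⟨u, hu, hu'⟩ := (hA t ht).1
      have h1 := descentRatio_div_le hp ht htt hu
      have h2 := (hA t' ht').2 (mem_image_of_mem _ hu)
      rw [hu'] at h1
      exact (div_le_div_of_nonneg_right h2
        (Real.rpow_nonneg (by linarith [mem_Ioi.1 ht']) _)).trans h1
    · exact ((Real.continuous_rpow_const (by linarith)).comp
        (continuous_id.sub continuous_const)).continuousOn
  have hg0 : ∀ t ∈ Ioi (1 : ℝ), 0 < (t ^ p - 1) / t ^ (p - 1) := by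
    intro t ht
    have := Real.one_lt_rpow ht (by linarith : 0 < p)
    exact div_pos (by linarith) (Real.rpow_pos_of_pos (by linarith [mem_Ioi.1 ht]) _)
  -- The continuity criterion is for increasing functions, hence the reciprocal.
  have hBc : ContinuousOn (fun t => (B t)⁻¹) (Ioi 1) := by
    refine continuousOn_of_monotoneOn_of_antitoneOn_div
      (g := fun t => (t ^ p - 1) / t ^ (p - 1)) (fun t ht => (inv_pos.2 (hB0 t ht)).le)
      ?_ ?_ hg0 ?_
    · intro t ht t' ht' htt
      exact inv_anti₀ (hB0 t' ht') (hBm.antitoneOn ht ht' htt)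
    · intro t ht t' ht' htt
      obtain ⟨u, hu, hu'⟩ := (hB t ht).1
      have ht0 : 0 < t := by linarith [mem_Ioi.1 ht]
      have h1 := ascentRatio_mul_le hp ht htt hu
      have h2 := (hB t' ht').2 (mem_image_of_mem (ascentRatio p t') (show t' / t * u ∈ Ioi t' by
        rw [mem_Ioi, div_mul_eq_mul_div, lt_div_iff₀ ht0]
        exact mul_lt_mul_of_pos_left hu (by linarith)))
      rw [hu'] at h1
      have h3 := h1.trans (mul_le_mul_of_nonneg_right h2 (hg0 t' ht').le)
      simp only [div_eq_mul_inv _ (_ / _), ← mul_inv]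
      exact inv_anti₀ (mul_pos (hB0 t ht) (hg0 t ht)) h3
    · refine ContinuousOn.div ?_ ?_ ?_
      · exact ((Real.continuous_rpow_const (by linarith)).sub continuous_const).continuousOn
      · exact (Real.continuous_rpow_const (by linarith)).continuousOn
      · intro t ht
        exact (Real.rpow_pos_of_pos (by linarith [mem_Ioi.1 ht]) _).ne'
  have hBc' : ContinuousOn B (Ioi 1) := by
    have := hBc.inv₀ (fun t ht => (inv_pos.2 (hB0 t ht)).ne')
    exact this.congr fun t _ => by simp
  obtain ⟨t₀, u, v, h1, h2, hu, hv, huv⟩ := exists_descentRatio_lt_ascentRatio hp hp2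
  have hlow : A t₀ < B t₀ := ((hA t₀ h1).2 (mem_image_of_mem _ hu)).trans_lt
    (huv.trans_le ((hB t₀ h1).2 (mem_image_of_mem _ hv)))
  -- At t = 2 the value 1 separates the two extremes.
  have hhigh : B 2 < A 2 := by
    obtain ⟨u, hu, hu'⟩ := (hA 2 one_lt_two).1
    obtain ⟨v, hv, hv'⟩ := (hB 2 one_lt_two).1
    rw [mem_Ioi] at hv
    have hup := Real.rpow_lt_one hu.1 hu.2 (by linarith : 0 < p)
    have hup0 := Real.rpow_nonneg hu.1 p
    have hv1 := Real.one_lt_rpow (by linarith : 1 < v) (by linarith : 0 < p - 1)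
    have e : v ^ p = v ^ (p - 1) * v := by
      rw [← Real.rpow_add_one (by linarith)]; congr 1; ring
    have hAB : B 2 < 1 := by
      rw [← hv', ascentRatio, div_lt_one (by nlinarith)]
      calc (v - 2) ^ (p - 1) ≤ v ^ (p - 1) :=
            Real.rpow_le_rpow (by linarith) (by linarith) (by linarith)
        _ < _ := by nlinarith
    have : 1 ≤ A 2 := by
      rw [← hu', descentRatio, one_le_div (by linarith)]
      have := Real.one_le_rpow (by linarith [hu.2] : 1 ≤ 2 - u) (by linarith : 0 ≤ p - 1)
      linarith
    linarith
  have hsub : Icc t₀ 2 ⊆ Ioi 1 := fun x hx => h1.trans_le hx.1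
  obtain ⟨τ, hτ, hτ0⟩ := intermediate_value_Icc h2.le ((hAc.sub hBc').mono hsub)
    (show (0 : ℝ) ∈ Icc _ _ from ⟨by simpa using hlow.le, by simpa using hhigh.le⟩)
  have hτ1 : 1 < τ := hsub hτ
  have heq : A τ = B τ := sub_eq_zero.1 hτ0
  refine ⟨τ, hτ1, heq, fun t ht htt => ?_, fun t htt => ?_⟩
  · have a := hAm ht hτ1 htt
    have b := hBm ht hτ1 htt
    linarith
  · have a := hAm hτ1 (hτ1.trans htt) htt
    have b := hBm hτ1 (hτ1.trans htt) htt
    linarith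

end EllPA

/-! ### The extremal functional: its sign, the first-order condition and the recurrence. -/

noncomputable section

namespace EllPA

open Set Filter Topology

@[simp] theorem prev_zero (f : PowerSeries ℂ) : prev f 0 = 0 := rfl

@[simp] theorem prev_succ (f : PowerSeries ℂ) (k : ℕ) :
    prev f (k + 1) = PowerSeries.coeff k f := rfl

theorem coeff_twist (t : ℂ) (f : PowerSeries ℂ) (k : ℕ) :
    PowerSeries.coeff k (twist t f) = PowerSeries.coeff k f - t * prev f k := by
  rw [twist, sub_mul, one_mul, map_sub, mul_assoc, PowerSeries.coeff_C_mul]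
  cases k with
  | zero => simp
  | succ k => rw [mul_comm PowerSeries.X, PowerSeries.coeff_succ_mul_X, prev_succ]

/-- The terms of the derivative of `‖(1 - t z) f(z)‖_p ^ p / p` in the direction `-w`. -/
def pairing (p : ℝ) (t w : ℂ) (f : PowerSeries ℂ) (k : ℕ) : ℝ :=
  ‖PowerSeries.coeff k f - t * prev f k‖ ^ (p - 2) *
    inner ℝ (PowerSeries.coeff k f - t * prev f k) (w * prev f k)

theorem Mem.summable_prev {p : ℝ} {f : PowerSeries ℂ} (hf : Mem p f) :
    Summable fun k => ‖prev f k‖ ^ p := by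
  rw [← summable_nat_add_iff 1]
  exact hf

theorem Mem.tsum_prev {p : ℝ} (hp : 1 < p) {f : PowerSeries ℂ} (hf : Mem p f) :
    ∑' k, ‖prev f k‖ ^ p = ∑' k, ‖PowerSeries.coeff k f‖ ^ p := by
  rw [(hf.summable_prev).tsum_eq_zero_add]
  simp [Real.zero_rpow (by linarith : p ≠ 0)]

theorem add_rpow_le {p a b : ℝ} (hp : 1 < p) (ha : 0 ≤ a) (hb : 0 ≤ b) :
    (a + b) ^ p ≤ 2 ^ p * (a ^ p + b ^ p) := by
  have h1 : (a + b) ^ p ≤ (2 * max a b) ^ p :=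
    Real.rpow_le_rpow (by positivity) (by linarith [le_max_left a b, le_max_right a b])
      (by linarith)
  rw [Real.mul_rpow (by norm_num) (le_max_of_le_left ha)] at h1
  refine h1.trans (mul_le_mul_of_nonneg_left ?_ (by positivity))
  rcases max_cases a b with h | h <;> rw [h.1]
  · linarith [Real.rpow_nonneg hb p]
  · linarith [Real.rpow_nonneg ha p]

theorem Mem.summable_majorant {p : ℝ} (hp : 1 < p) {f : PowerSeries ℂ} (hf : Mem p f) {R : ℝ}
    (hR : 0 ≤ R) : Summable fun k => (‖PowerSeries.coeff k f‖ + R * ‖prev f k‖) ^ p := by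
  refine Summable.of_nonneg_of_le (fun k => by positivity)
    (fun k => add_rpow_le hp (norm_nonneg _) (by positivity)) ?_
  simp_rw [Real.mul_rpow hR (norm_nonneg _)]
  exact (hf.add ((hf.summable_prev).mul_left _)).mul_left _

theorem norm_residual_le {t x y : ℂ} {R : ℝ} (ht : ‖t‖ ≤ R) :
    ‖y - t * x‖ ≤ ‖y‖ + R * ‖x‖ := by
  refine (norm_sub_le _ _).trans ?_
  rw [norm_mul]
  gcongr

theorem Mem.summable_residual {p : ℝ} (hp : 1 < p) {f : PowerSeries ℂ} (hf : Mem p f) (t : ℂ) :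
    Summable fun k => ‖PowerSeries.coeff k f - t * prev f k‖ ^ p :=
  (hf.summable_majorant hp (norm_nonneg t)).of_nonneg_of_le (fun k => by positivity)
    fun k => Real.rpow_le_rpow (norm_nonneg _) (norm_residual_le le_rfl) (by linarith)

/-- The bound is uniform in t and w of norm at most R, which permits differentiation of the norm
series term by term. -/
theorem abs_pairing_le {p : ℝ} (hp : 1 < p) (f : PowerSeries ℂ) {t w : ℂ} {R : ℝ}
    (ht : ‖t‖ ≤ R) (hw : ‖w‖ ≤ R) (k : ℕ) :
    |pairing p t w f k| ≤ (‖PowerSeries.coeff k f‖ + R * ‖prev f k‖) ^ p := by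
  have hR : 0 ≤ R := (norm_nonneg t).trans ht
  rw [pairing]
  set z := PowerSeries.coeff k f - t * prev f k with hz
  set M := ‖PowerSeries.coeff k f‖ + R * ‖prev f k‖ with hM
  have hzM : ‖z‖ ≤ M := norm_residual_le ht
  have hwM : ‖w * prev f k‖ ≤ M := by
    rw [norm_mul]
    have : ‖w‖ * ‖prev f k‖ ≤ R * ‖prev f k‖ := by gcongr
    linarith [norm_nonneg (PowerSeries.coeff k f)]
  rcases eq_or_ne z 0 with h0 | h0
  · rw [h0]
    simp only [inner_zero_left, mul_zero, abs_zero]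
    positivity
  have hzp : 0 < ‖z‖ := norm_pos_iff.2 h0
  have hMp : 0 < M := hzp.trans_le hzM
  rw [abs_mul, abs_of_nonneg (by positivity)]
  calc ‖z‖ ^ (p - 2) * |inner ℝ z (w * prev f k)|
      ≤ ‖z‖ ^ (p - 2) * (‖z‖ * ‖w * prev f k‖) := by
        gcongr; exact abs_real_inner_le_norm _ _
    _ = ‖z‖ ^ (p - 1) * ‖w * prev f k‖ := by
        rw [show p - 1 = p - 2 + 1 by ring, Real.rpow_add_one hzp.ne']; ring
    _ ≤ M ^ (p - 1) * M := by
        have := Real.rpow_le_rpow hzp.le hzM (by linarith : 0 ≤ p - 1)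
        gcongr
    _ = M ^ p := by rw [← Real.rpow_add_one hMp.ne']; congr 1; ring

theorem Mem.summable_pairing {p : ℝ} (hp : 1 < p) {f : PowerSeries ℂ} (hf : Mem p f) (t w : ℂ) :
    Summable (pairing p t w f) :=
  (hf.summable_majorant hp (le_max_of_le_left (norm_nonneg t) :
    0 ≤ max ‖t‖ ‖w‖)).of_norm_bounded fun k =>
      abs_pairing_le hp f (le_max_left _ _) (le_max_right _ _) k

theorem exists_coeff_ne_zero_prev_eq_zero {f : PowerSeries ℂ} (hf : f ≠ 0) :
    ∃ k, PowerSeries.coeff k f ≠ 0 ∧ prev f k = 0 := by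
  classical
  have h : ∃ k, PowerSeries.coeff k f ≠ 0 := by
    by_contra! h
    exact hf (PowerSeries.ext h)
  refine ⟨Nat.find h, Nat.find_spec h, ?_⟩
  rcases hk : Nat.find h with _ | k
  · rfl
  · by_contra h'
    exact Nat.find_min h (by omega : k < Nat.find h) h'

/-- The extremal functional is negative where the one-step inequality holds. -/
theorem Separates.tsum_pairing_neg {p ρ c : ℝ} (H : Separates p ρ c) (hp : 1 < p) (hp2 : p ≠ 2)
    (hρ : 1 < ρ) {f : PowerSeries ℂ} (hf : Mem p f) (hf0 : f ≠ 0) {w : ℂ} (hw : ‖w‖ = 1) :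
    ∑' k, pairing p (ρ * w) w f k < 0 := by
  have hstep : ∀ k, pairing p (ρ * w) w f k ≤
      c * (‖PowerSeries.coeff k f‖ ^ p - ‖prev f k‖ ^ p) := fun k => by
    have := H.inner_le hp hp2 hρ (w * prev f k) (PowerSeries.coeff k f)
    rwa [← mul_assoc, norm_mul, hw, one_mul] at this
  obtain ⟨m, hm, hm0⟩ := exists_coeff_ne_zero_prev_eq_zero hf0
  have hd := (hf.sub (hf.summable_prev)).mul_left c
  have hs := hf.summable_pairing hp (ρ * w) w
  -- At the first nonzero coefficient the term of the functional is 0 but the bound is `c |a_m| ^ p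
  -- > 0`. This makes the total strictly negative.
  have hpos := (hd.sub hs).tsum_pos (fun k => sub_nonneg.2 (hstep k)) m (by
    have := H.pos
    have := norm_pos_iff.2 hm
    rw [pairing, hm0]
    simp [Real.zero_rpow (by linarith : p ≠ 0)]
    positivity)
  rw [hd.tsum_sub hs, tsum_mul_left, hf.tsum_sub (hf.summable_prev), hf.tsum_prev hp] at hpos
  simpa using hpos

theorem isOpt_iff {p : ℝ} (hp : 1 < p) {f : PowerSeries ℂ} {t : ℂ} :
    IsOpt p f t ↔ ∀ s : ℂ, ∑' k, ‖PowerSeries.coeff k f - t * prev f k‖ ^ p ≤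
      ∑' k, ‖PowerSeries.coeff k f - s * prev f k‖ ^ p := by
  refine forall_congr' fun s => ?_
  simp only [norm, coeff_twist]
  exact Real.rpow_le_rpow_iff (tsum_nonneg fun k => by positivity)
    (tsum_nonneg fun k => by positivity) (by positivity)

/-- The first-order condition for the optimal parameter. -/
theorem IsOpt.tsum_pairing_eq_zero {p : ℝ} (hp : 1 < p) {f : PowerSeries ℂ} (hf : Mem p f) {t : ℂ}
    (h : IsOpt p f t) (w : ℂ) : ∑' k, pairing p t w f k = 0 := by
  rw [isOpt_iff hp] at h
  -- R bounds both `|t + r w|` for |r| < 1 and `|w|`.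
  set R := ‖t‖ + ‖w‖ with hR
  have hd : HasDerivAt
      (fun r : ℝ => ∑' k, ‖PowerSeries.coeff k f - (t + r * w) * prev f k‖ ^ p)
      (∑' k, -(p * pairing p (t + (0 : ℝ) * w) w f k)) 0 := by
    refine hasDerivAt_tsum_of_isPreconnected
      (g' := fun k r => -(p * pairing p (t + (r : ℝ) * w) w f k))
      (((hf.summable_majorant hp (by positivity : 0 ≤ R)).mul_left p))
      isOpen_Ioo (isPreconnected_Ioo (a := (-1 : ℝ)) (b := 1)) ?_ ?_
      (by simp : (0 : ℝ) ∈ _) ?_ (by simp)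
    · intro k r _
      have h1 : HasDerivAt (fun r : ℝ => PowerSeries.coeff k f - (t + r * w) * prev f k)
          (-(w * prev f k)) r := by
        have := ((((Complex.ofRealCLM.hasDerivAt (x := r)).mul_const w).const_add t).mul_const
          (prev f k)).const_sub (PowerSeries.coeff k f)
        simpa using this
      refine ((hasFDerivAt_norm_rpow _ hp).comp_hasDerivAt r h1).congr_deriv ?_
      simp only [pairing, _root_.smul_apply, innerSL_apply_apply, smul_eq_mul,
        inner_neg_right]
      ring
    · intro k r hr
      rw [norm_neg, norm_mul, Real.norm_eq_abs, abs_of_pos (by linarith)]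
      refine mul_le_mul_of_nonneg_left (abs_pairing_le hp f ?_ ?_ k) (by linarith)
      · refine (norm_add_le _ _).trans ?_
        rw [norm_mul, Complex.norm_real, Real.norm_eq_abs]
        have := abs_le.2 ⟨hr.1.le, hr.2.le⟩
        nlinarith [norm_nonneg w]
      · linarith [norm_nonneg t]
    · exact hf.summable_residual hp _
  have hmin : IsLocalMin
      (fun r : ℝ => ∑' k, ‖PowerSeries.coeff k f - (t + r * w) * prev f k‖ ^ p) 0 :=
    Eventually.of_forall fun r => by simpa using h (t + r * w)
  have h0 := hmin.hasDerivAt_eq_zero hd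
  rw [tsum_neg, tsum_mul_left, neg_eq_zero] at h0
  simpa [(by linarith : p ≠ 0)] using h0

/-- A recurrence relation makes the corresponding term of the functional a difference. -/
theorem Rec.pairing_succ {p t : ℝ} {f : PowerSeries ℂ} {k : ℕ} (h : Rec p t f k) :
    p * pairing p t 1 f (k + 1) = (p - 1) *
      (‖PowerSeries.coeff (k + 1) f - t * prev f (k + 1)‖ ^ (p - 2) *
        inner ℝ (PowerSeries.coeff (k + 1) f) (prev f (k + 1)) -
      ‖PowerSeries.coeff k f - t * prev f k‖ ^ (p - 2) *
        inner ℝ (PowerSeries.coeff k f) (prev f k)) := by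
  rw [Rec] at h
  simp only [pairing, prev_succ, one_mul]
  set r := ‖PowerSeries.coeff (k + 1) f - t * PowerSeries.coeff k f‖ ^ (p - 2)
  set r' := ‖PowerSeries.coeff k f - t * prev f k‖ ^ (p - 2)
  -- The real inner product of the relation with `a_k` is the claimed identity.
  have h1 := congrArg (fun z : ℂ => inner ℝ z (PowerSeries.coeff k f)) h
  simp only [Complex.inner] at h1 ⊢
  simp at h1 ⊢
  linear_combination -h1

/-- The relations turn p times a partial sum of the functional into `(p - 1) X n`. Here `X n`
exceeds the n-th term by `ρ |a_n - ρ a_{n-1}| ^ (p - 2) |a_{n-1}| ^ 2 ≥ 0`. As the terms tend to 0,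
the total is nonnegative, against its negativity. -/
theorem not_forall_rec {p ρ c : ℝ} (H : Separates p ρ c) (hp : 1 < p) (hp2 : p ≠ 2)
    (hρ : 1 < ρ) {f : PowerSeries ℂ} (hf : Mem p f) (hf0 : f ≠ 0) : ¬ ∀ k, Rec p ρ f k := by
  intro h
  have hneg := H.tsum_pairing_neg hp hp2 hρ hf hf0 (w := 1) (by simp)
  rw [mul_one] at hneg
  set X : ℕ → ℝ := fun k => ‖PowerSeries.coeff k f - ρ * prev f k‖ ^ (p - 2) *
    inner ℝ (PowerSeries.coeff k f) (prev f k) with hX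
  have hsum : ∀ n, p * ∑ k ∈ Finset.range (n + 1), pairing p ρ 1 f k = (p - 1) * X n := by
    intro n
    induction n with
    | zero => simp [pairing, hX]
    | succ n ih =>
      rw [Finset.sum_range_succ, mul_add, ih, (h n).pairing_succ]
      ring
  have hs := hf.summable_pairing hp ρ 1
  have hXlim : Tendsto (fun n => (p - 1) * X n) atTop (𝓝 (p * ∑' k, pairing p ρ 1 f k)) := by
    have := ((tendsto_add_atTop_iff_nat 1).2 hs.hasSum.tendsto_sum_nat).const_mul p
    exact this.congr hsum
  have hle : ∀ k, (p - 1) * pairing p ρ 1 f k ≤ (p - 1) * X k := by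
    intro k
    refine mul_le_mul_of_nonneg_left ?_ (by linarith)
    rw [pairing, hX]
    refine mul_le_mul_of_nonneg_left ?_ (by positivity)
    rw [one_mul, inner_sub_left]
    have : (ρ : ℂ) * prev f k = ρ • prev f k := by simp
    rw [this, real_inner_smul_left, real_inner_self_eq_norm_sq]
    have : 0 ≤ ρ * ‖prev f k‖ ^ 2 := by positivity
    linarith
  have := le_of_tendsto_of_tendsto' (hs.tendsto_atTop_zero.const_mul (p - 1)) hXlim hle
  nlinarith

theorem mem_coe_polynomial {p : ℝ} (hp : 1 < p) (f : Polynomial ℂ) :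
    Mem p (f : PowerSeries ℂ) := by
  refine summable_of_ne_finset_zero (s := Finset.range (f.natDegree + 1)) fun k hk => ?_
  rw [Polynomial.coeff_coe, Polynomial.coeff_eq_zero_of_natDegree_lt (by simpa using hk)]
  simp [Real.zero_rpow (by linarith : p ≠ 0)]

/-- The relations up to k = d already telescope to index d + 1, where `a_{d+1} = 0` kills the
boundary term. The total would be 0. -/
theorem not_forall_le_rec {p ρ c : ℝ} (H : Separates p ρ c) (hp : 1 < p) (hp2 : p ≠ 2)
    (hρ : 1 < ρ) {d : ℕ} {f : Polynomial ℂ} (hf0 : f ≠ 0) (hd : f.natDegree ≤ d) :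
    ¬ ∀ k ≤ d, Rec p ρ (f : PowerSeries ℂ) k := by
  intro h
  have hf := mem_coe_polynomial hp f
  have hneg := H.tsum_pairing_neg hp hp2 hρ hf (by simpa using hf0) (w := 1) (by simp)
  rw [mul_one] at hneg
  have hcoeff : ∀ k, d < k → PowerSeries.coeff k (f : PowerSeries ℂ) = 0 := fun k hk => by
    rw [Polynomial.coeff_coe, Polynomial.coeff_eq_zero_of_natDegree_lt (by omega)]
  have hsum : ∀ n ≤ d + 1, p * ∑ k ∈ Finset.range (n + 1), pairing p ρ 1 f k =
      (p - 1) * (‖PowerSeries.coeff n (f : PowerSeries ℂ) - ρ * prev f n‖ ^ (p - 2) *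
    inner ℝ (PowerSeries.coeff n (f : PowerSeries ℂ)) (prev f n)) := by
    intro n
    induction n with
    | zero => simp [pairing]
    | succ n ih =>
      intro hn
      rw [Finset.sum_range_succ, mul_add, ih (by omega), (h n (by omega)).pairing_succ]
      ring
  have h0 := hsum (d + 1) le_rfl
  have htail : ∀ k ∉ Finset.range (d + 1 + 1), pairing p ρ 1 (f : PowerSeries ℂ) k = 0 := by
    intro k hk
    obtain ⟨k, rfl⟩ : ∃ j, k = j + 1 := ⟨k - 1, by simp at hk; omega⟩
    rw [pairing, prev_succ, hcoeff k (by simp at hk; omega)]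
    simp
  have htot : ∑' k, pairing p ρ 1 (f : PowerSeries ℂ) k = _ := tsum_eq_sum htail
  rw [hcoeff (d + 1) (by omega), inner_zero_left, mul_zero, mul_zero, ← htot] at h0
  nlinarith

/-- The subgradient inequality for the power of the norm. -/
theorem norm_rpow_add_inner_le {p : ℝ} (hp : 1 < p) (z w : ℂ) :
    ‖z‖ ^ p + p * (‖z‖ ^ (p - 2) * inner ℝ z (w - z)) ≤ ‖w‖ ^ p := by
  rcases eq_or_ne z 0 with rfl | hz
  · simp [Real.zero_rpow (by linarith : p ≠ 0)]
    positivity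
  have hz0 : 0 < ‖z‖ := norm_pos_iff.2 hz
  have h1 := one_add_mul_self_le_rpow_one_add (s := ‖w‖ / ‖z‖ - 1) (p := p)
    (by linarith [div_nonneg (norm_nonneg w) hz0.le]) hp.le
  rw [add_sub_cancel, Real.div_rpow (norm_nonneg _) hz0.le, le_div_iff₀ (by positivity)] at h1
  refine le_trans ?_ h1
  have e : ‖z‖ ^ p = ‖z‖ ^ (p - 2) * ‖z‖ ^ 2 := by
    rw [← Real.rpow_natCast, ← Real.rpow_add hz0]; congr 1; push_cast; ring
  have h2 : inner ℝ z (w - z) ≤ ‖z‖ * ‖w‖ - ‖z‖ ^ 2 := by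
    rw [inner_sub_right, real_inner_self_eq_norm_sq]
    linarith [real_inner_le_norm z w]
  have h3 : (1 + p * (‖w‖ / ‖z‖ - 1)) * ‖z‖ ^ p =
      ‖z‖ ^ p + p * (‖z‖ ^ (p - 2) * (‖z‖ * ‖w‖ - ‖z‖ ^ 2)) := by
    rw [e]; field_simp
  rw [h3]
  gcongr

/-- The top coefficient of the twisted polynomial is -s times the leading coefficient, so the norm
is coercive in s. -/
theorem exists_isOpt {p : ℝ} (hp : 1 < p) {f : Polynomial ℂ} (hf : f ≠ 0) :
    ∃ t, IsOpt p (f : PowerSeries ℂ) t := by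
  have hmem := mem_coe_polynomial hp f
  have hfin : ∀ s : ℂ, ∑' k, ‖PowerSeries.coeff k (f : PowerSeries ℂ) - s * prev f k‖ ^ p =
      ∑ k ∈ Finset.range (f.natDegree + 2),
        ‖PowerSeries.coeff k (f : PowerSeries ℂ) - s * prev f k‖ ^ p := fun s => by
    refine tsum_eq_sum fun k hk => ?_
    obtain ⟨k, rfl⟩ : ∃ j, k = j + 1 := ⟨k - 1, by simp at hk; omega⟩
    simp only [Finset.mem_range, not_lt] at hk
    rw [prev_succ, Polynomial.coeff_coe, Polynomial.coeff_coe,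
      Polynomial.coeff_eq_zero_of_natDegree_lt (by omega),
      Polynomial.coeff_eq_zero_of_natDegree_lt (by omega)]
    simp [Real.zero_rpow (by linarith : p ≠ 0)]
  have hcont : Continuous fun s : ℂ =>
      ∑' k, ‖PowerSeries.coeff k (f : PowerSeries ℂ) - s * prev f k‖ ^ p := by
    simp_rw [hfin]
    exact continuous_finsetSum _ fun k _ => Continuous.rpow_const (by fun_prop)
      fun _ => Or.inr (by linarith)
  have hlim : Tendsto (fun s : ℂ =>
      ∑' k, ‖PowerSeries.coeff k (f : PowerSeries ℂ) - s * prev f k‖ ^ p)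
      (cocompact ℂ) atTop := by
    have h1 : Tendsto (fun s : ℂ => (‖s‖ * ‖f.leadingCoeff‖) ^ p) (cocompact ℂ) atTop :=
      (tendsto_rpow_atTop (by linarith)).comp ((tendsto_norm_cocompact_atTop (E := ℂ)).atTop_mul_const
        (norm_pos_iff.2 (Polynomial.leadingCoeff_ne_zero.2 hf)))
    refine tendsto_atTop_mono (fun s => ?_) h1
    have := (hmem.summable_residual hp s).le_tsum (f.natDegree + 1) fun k _ => by positivity
    rwa [prev_succ, Polynomial.coeff_coe, Polynomial.coeff_coe,
      Polynomial.coeff_eq_zero_of_natDegree_lt (by omega), zero_sub, norm_neg, norm_mul] at this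
  obtain ⟨t, ht⟩ := hcont.exists_forall_le hlim
  exact ⟨t, (isOpt_iff hp).2 ht⟩

/-- Positivity of the functional at `t` pushes the optimal parameter beyond `t`. -/
theorem IsOpt.le_norm {p t : ℝ} (hp : 1 < p) {f : PowerSeries ℂ} (hf : Mem p f)
    (hreal : ∀ k, (PowerSeries.coeff k f).im = 0) (hpos : 0 < ∑' k, pairing p t 1 f k) {s : ℂ}
    (hs : IsOpt p f s) : t ≤ ‖s‖ := by
  refine le_trans ?_ (Complex.re_le_norm s)
  by_contra! hlt
  have hprev : ∀ k, (prev f k).im = 0 := fun k => by cases k <;> simp [hreal]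
  -- Since the coefficients are real, only the real part of s enters the subgradient term. If it
  -- were below t, the norm at s would exceed the norm at t.
  have hstep : ∀ k, ‖PowerSeries.coeff k f - t * prev f k‖ ^ p +
      p * (t - s.re) * pairing p t 1 f k ≤ ‖PowerSeries.coeff k f - s * prev f k‖ ^ p := by
    intro k
    refine le_trans (le_of_eq ?_) (norm_rpow_add_inner_le hp
      (PowerSeries.coeff k f - t * prev f k) (PowerSeries.coeff k f - s * prev f k))
    rw [pairing, Complex.inner, Complex.inner]
    simp [hreal, hprev]
    ring
  have h1 := ((hf.summable_residual hp t).add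
    ((hf.summable_pairing hp t 1).mul_left (p * (t - s.re)))).tsum_le_tsum hstep
    (hf.summable_residual hp s)
  rw [(hf.summable_residual hp t).tsum_add ((hf.summable_pairing hp t 1).mul_left _),
    tsum_mul_left] at h1
  have h2 := (isOpt_iff hp).1 hs t
  have h3 : 0 < p * (t - s.re) * ∑' k, pairing p t 1 f k :=
    mul_pos (mul_pos (by linarith) (by linarith)) hpos
  linarith

end EllPA

end

/-! ### Geometric test polynomials and the lower bound. -/

noncomputable section

namespace EllPA

open Set Filter Topology

/-- The real form of the terms of the extremal functional. -/
def realPairing (p t x y : ℝ) : ℝ := |y - t * x| ^ (p - 2) * ((y - t * x) * x)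

theorem realPairing_mul {p t x u : ℝ} (hp : 1 < p) (hx : 0 ≤ x) :
    realPairing p t x (u * x) = |u - t| ^ (p - 2) * (u - t) * x ^ p := by
  rw [realPairing, ← sub_mul, abs_mul, abs_of_nonneg hx,
    Real.mul_rpow (abs_nonneg _) hx]
  rcases hx.eq_or_lt with rfl | hx
  · simp [Real.zero_rpow (by linarith : p ≠ 0)]
  · have e : x ^ p = x ^ (p - 2) * x ^ 2 := by
      rw [← Real.rpow_natCast, ← Real.rpow_add hx]; congr 1; push_cast; ring
    rw [e]; ring

/-- Along a constant ratio the one-step bound is an equality with this ratio's own constant, so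
geometric stretches telescope exactly. -/
theorem realPairing_ascent {p t x v : ℝ} (hp : 1 < p) (ht : 1 < t) (hv : t < v) (hx : 0 ≤ x) :
    realPairing p t x (v * x) = ascentRatio p t v * ((v * x) ^ p - x ^ p) := by
  have h1 : 0 < v - t := by linarith
  have h2 := Real.one_lt_rpow (by linarith : 1 < v) (by linarith : 0 < p)
  rw [realPairing_mul hp hx, abs_of_pos h1, ← Real.rpow_add_one h1.ne',
    Real.mul_rpow (by linarith) hx, ascentRatio, show p - 2 + 1 = p - 1 by ring]
  field_simp [(by linarith : v ^ p - 1 ≠ 0)]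

theorem realPairing_descent {p t x u : ℝ} (hp : 1 < p) (ht : 1 < t) (hu : u ∈ Ico (0 : ℝ) 1)
    (hx : 0 ≤ x) :
    realPairing p t x (u * x) = descentRatio p t u * ((u * x) ^ p - x ^ p) := by
  have h1 : 0 < t - u := by linarith [hu.2]
  have h2 := Real.rpow_lt_one hu.1 hu.2 (by linarith : 0 < p)
  have h3 : 1 - u ^ p ≠ 0 := by linarith
  rw [realPairing_mul hp hx, abs_sub_comm, abs_of_pos h1, ← neg_sub t u, mul_neg,
    ← Real.rpow_add_one h1.ne', Real.mul_rpow hu.1 hx, descentRatio,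
    show p - 2 + 1 = p - 1 by ring]
  field_simp
  ring

/-- Geometric growth followed by geometric decay makes the functional positive. -/
theorem exists_sum_realPairing_pos {p t u v : ℝ} (hp : 1 < p) (ht : 1 < t)
    (hu : u ∈ Ico (0 : ℝ) 1) (hv : t < v) (h : descentRatio p t u < ascentRatio p t v) :
    ∃ (N : ℕ) (a : ℕ → ℝ), a 0 = 1 ∧
      0 < ∑ k ∈ Finset.range N, realPairing p t (a k) (a (k + 1)) + realPairing p t (a N) 0 := by
  set c₁ := descentRatio p t u
  set c₂ := ascentRatio p t v
  have hv0 : 0 < v := by linarith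
  have hvp := Real.one_lt_rpow (by linarith : 1 < v) (by linarith : 0 < p)
  have hup := Real.rpow_lt_one hu.1 hu.2 (by linarith : 0 < p)
  have hup0 := Real.rpow_nonneg hu.1 p
  have hc1 : 0 ≤ c₁ := div_nonneg (Real.rpow_nonneg (by linarith [hu.2]) _) (by linarith)
  have htp : 0 < t ^ (p - 1) := Real.rpow_pos_of_pos (by linarith) _
  -- With `V = v ^ (p n)` and `U = u ^ (p m)` the sum is `c₂ (V - 1) - c₁ V (1 - U) - t ^ (p - 1) V
  -- U`. The choice of n makes c₂ less than half of `V (c₂ - c₁)`, and that of m does the same for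
  -- the final drop to 0.
  obtain ⟨n, hn⟩ := pow_unbounded_of_one_lt (2 * c₂ / (c₂ - c₁)) hvp
  obtain ⟨m, hm⟩ := exists_pow_lt_of_lt_one
    (div_pos (sub_pos.2 h) (mul_pos two_pos htp)) hup
  set a : ℕ → ℝ := fun k => if k ≤ n then v ^ k else v ^ n * u ^ (k - n) with ha
  have ha1 : ∀ k ≤ n, a k = v ^ k := fun k hk => if_pos hk
  have ha2 : ∀ j, a (n + j) = v ^ n * u ^ j := fun j => by
    rcases Nat.eq_zero_or_pos j with rfl | hj
    · simp [ha]
    · simp only [ha]; rw [if_neg (by omega), Nat.add_sub_cancel_left]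
  have ha0 : ∀ k, 0 ≤ a k := fun k => by
    have := hu.1
    simp only [ha]; split_ifs <;> positivity
  refine ⟨n + m, a, by simp [ha], ?_⟩
  have hs1 : ∑ k ∈ Finset.range n, realPairing p t (a k) (a (k + 1)) =
      c₂ * ((a n) ^ p - (a 0) ^ p) := by
    rw [← Finset.sum_range_sub (fun k => (a k) ^ p), Finset.mul_sum]
    refine Finset.sum_congr rfl fun k hk => ?_
    have hk := Finset.mem_range.1 hk
    have : a (k + 1) = v * a k := by
      rw [ha1 _ (by omega), ha1 _ (by omega), pow_succ']
    rw [this, realPairing_ascent hp ht hv (ha0 k)]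
  have hs2 : ∑ j ∈ Finset.range m, realPairing p t (a (n + j)) (a (n + j + 1)) =
      c₁ * ((a (n + m)) ^ p - (a n) ^ p) := by
    have htel := Finset.sum_range_sub (fun j => (a (n + j)) ^ p) m
    rw [add_zero] at htel
    rw [← htel, Finset.mul_sum]
    refine Finset.sum_congr rfl fun j _ => ?_
    have : a (n + j + 1) = u * a (n + j) := by
      rw [add_assoc, ha2, ha2, pow_succ']; ring
    rw [← add_assoc, this, realPairing_descent hp ht hu (ha0 _)]
  have hs3 : realPairing p t (a (n + m)) 0 = -(t ^ (p - 1) * (a (n + m)) ^ p) := by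
    have := realPairing_mul (t := t) (u := 0) hp (ha0 (n + m))
    rw [zero_mul] at this
    rw [this, zero_sub, abs_neg, abs_of_pos (by linarith), mul_neg,
      ← Real.rpow_add_one (by linarith), show p - 2 + 1 = p - 1 by ring]
    ring
  rw [Finset.sum_range_add, hs1, hs2, hs3, ha2 m, ha1 n le_rfl, ha1 0 (Nat.zero_le _), pow_zero,
    Real.one_rpow, Real.mul_rpow (by positivity) (pow_nonneg hu.1 _),
    ← Real.rpow_natCast v n, ← Real.rpow_mul hv0.le, mul_comm (n : ℝ) p, Real.rpow_mul hv0.le,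
    Real.rpow_natCast, ← Real.rpow_natCast u m, ← Real.rpow_mul hu.1, mul_comm (m : ℝ) p,
    Real.rpow_mul hu.1, Real.rpow_natCast]
  set V := (v ^ p) ^ n
  set U := (u ^ p) ^ m
  have hU : 0 ≤ U := pow_nonneg hup0 _
  have hV : 0 < V := by positivity
  rw [div_lt_iff₀ (by linarith)] at hn
  rw [lt_div_iff₀ (by positivity)] at hm
  have h1 : 0 < V * (c₂ - c₁ - 2 * (t ^ (p - 1) * U)) := mul_pos hV (by linarith)
  nlinarith [mul_nonneg hc1 (mul_nonneg hV.le hU)]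

/-- The polynomial with the given real coefficients up to degree `N`. -/
def realPolynomial (N : ℕ) (a : ℕ → ℝ) : Polynomial ℂ :=
  ∑ k ∈ Finset.range (N + 1), Polynomial.monomial k (a k : ℂ)

theorem coeff_realPolynomial (N : ℕ) (a : ℕ → ℝ) (k : ℕ) :
    PowerSeries.coeff k (realPolynomial N a : PowerSeries ℂ) =
      ((if k < N + 1 then a k else 0 : ℝ) : ℂ) := by
  rw [Polynomial.coeff_coe, realPolynomial, Polynomial.finsetSum_coeff]
  simp only [Polynomial.coeff_monomial, Finset.sum_ite_eq', Finset.mem_range]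
  split_ifs <;> simp

theorem tsum_pairing_realPolynomial (p t : ℝ) (N : ℕ) (a : ℕ → ℝ) :
    ∑' k, pairing p t 1 (realPolynomial N a : PowerSeries ℂ) k =
      ∑ k ∈ Finset.range N, realPairing p t (a k) (a (k + 1)) + realPairing p t (a N) 0 := by
  have hstep : ∀ k, pairing p t 1 (realPolynomial N a : PowerSeries ℂ) (k + 1) =
      realPairing p t (if k < N + 1 then a k else 0) (if k + 1 < N + 1 then a (k + 1) else 0) := by
    intro k
    rw [pairing, prev_succ, coeff_realPolynomial, coeff_realPolynomial, realPairing, one_mul,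
      ← Complex.ofReal_mul, ← Complex.ofReal_sub, Complex.norm_real, Real.norm_eq_abs,
      Complex.inner]
    simp [mul_comm]
  -- Index N + 1 still contributes, through the drop from `a N` to 0.
  rw [tsum_eq_sum (s := Finset.range (N + 2)) (fun k hk => by
    obtain ⟨k, rfl⟩ : ∃ j, k = j + 1 := ⟨k - 1, by simp at hk; omega⟩
    rw [hstep, if_neg (by simp at hk; omega), realPairing]
    simp), Finset.sum_range_succ', Finset.sum_range_succ]
  have h0 : pairing p t 1 (realPolynomial N a : PowerSeries ℂ) 0 = 0 := by simp [pairing]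
  rw [h0, add_zero, hstep, if_pos (by omega), if_neg (by omega)]
  congr 1
  refine Finset.sum_congr rfl fun k hk => ?_
  have := Finset.mem_range.1 hk
  rw [hstep, if_pos (by omega), if_pos (by omega)]

theorem T_le {p τ : ℝ} (hτ : 0 ≤ τ)
    (h : ∀ (f : Polynomial ℂ) t, f ≠ 0 → IsOpt p (f : PowerSeries ℂ) t → ‖t‖ ≤ τ) (d : ℕ) :
    T p d ≤ τ := by
  refine Real.sSup_le ?_ hτ
  rintro r ⟨f, t, hf, -, ht, rfl⟩
  exact h f t hf ht

/-- Below the threshold, polynomials of large degree exceed the given parameter. -/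
theorem eventually_le_T {p τ t u v : ℝ} (hp : 1 < p) (ht : 1 < t)
    (hτ : ∀ (f : Polynomial ℂ) s, f ≠ 0 → IsOpt p (f : PowerSeries ℂ) s → ‖s‖ ≤ τ)
    (hu : u ∈ Ico (0 : ℝ) 1) (hv : t < v) (h : descentRatio p t u < ascentRatio p t v) :
    ∀ᶠ d in atTop, t ≤ T p d := by
  obtain ⟨N, a, ha, hpos⟩ := exists_sum_realPairing_pos hp ht hu hv h
  have hf0 : realPolynomial N a ≠ 0 := by
    intro h0
    have := coeff_realPolynomial N a 0
    rw [h0] at this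
    simp [ha] at this
  obtain ⟨s, hs⟩ := exists_isOpt hp hf0
  rw [← tsum_pairing_realPolynomial] at hpos
  have hts : t ≤ ‖s‖ := hs.le_norm hp (mem_coe_polynomial hp _)
    (fun k => by rw [coeff_realPolynomial, Complex.ofReal_im]) hpos
  filter_upwards [eventually_ge_atTop (realPolynomial N a).natDegree] with d hd
  refine hts.trans (le_csSup ⟨τ, ?_⟩ ⟨_, s, hf0, hd, hs, rfl⟩)
  rintro r ⟨f, t, hf, -, ht, rfl⟩
  exact hτ f t hf ht

end EllPA

end

/-! ### Assembly of the theorem. -/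

open EllPA Set Filter Topology in
theorem theorem7p4 (p : ℝ) (hp : 1 < p) (hp2 : p ≠ 2) :
    ∃ ξ₁ ξ₂ : ℝ → ℝ,
      -- for every t > 1 there are exactly two positive roots, ξ₁ t < ξ₂ t
      (∀ t : ℝ, 1 < t → ξ₁ t < ξ₂ t ∧
        {x : ℝ | 0 < x ∧ x ^ (p - 1) * (p * t - x) = p - 1} = {ξ₁ t, ξ₂ t}) ∧
      ∃ τ : ℝ,
        -- τ is the unique t > 1 at which the two values agree
        (1 < τ ∧
          (p * τ - ξ₁ τ) * |ξ₁ τ - τ| ^ (p - 2) = (p * τ - ξ₂ τ) * |ξ₂ τ - τ| ^ (p - 2)) ∧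
        (∀ t : ℝ, 1 < t →
          (p * t - ξ₁ t) * |ξ₁ t - t| ^ (p - 2) = (p * t - ξ₂ t) * |ξ₂ t - t| ^ (p - 2) →
          t = τ) ∧
        -- τ is the extremal value, and the limit of the values in bounded degree
        τ = EllPA.tau p ∧
        Filter.Tendsto (EllPA.T p) Filter.atTop (nhds (EllPA.tau p)) ∧
        -- no nontrivial solution of all the recurrence relations lies in the space
        (∀ f : PowerSeries ℂ, EllPA.Mem p f → f ≠ 0 →
          ¬ ∀ k : ℕ, EllPA.Rec p (EllPA.tau p) f k) ∧
        -- no nonzero polynomial solves the relations of its degree bound d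
        (∀ (d : ℕ) (f : Polynomial ℂ), f ≠ 0 → f.natDegree ≤ d →
          ¬ ∀ k : ℕ, k ≤ d → EllPA.Rec p (EllPA.tau p) (f : PowerSeries ℂ) k) ∧
        -- the extremal value is not attained
        (∀ f : PowerSeries ℂ, EllPA.Mem p f → f ≠ 0 →
          ∀ t : ℂ, EllPA.IsOpt p f t → ‖t‖ ≠ EllPA.tau p) := by
  choose! ξ₁ ξ₂ h0 h1 h2 e1 e2 using fun t (ht : 1 < t) => exists_charFun_zeros hp ht
  have hA : ∀ t, 1 < t → IsLeast (descentRatio p t '' Ico 0 1) (descentRatio p t (ξ₁ t)) :=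
    fun t ht => ⟨mem_image_of_mem _ ⟨(h0 t ht).le, h1 t ht⟩, by
      rintro _ ⟨u, hu, rfl⟩
      exact isMinOn_descentRatio hp ht (h0 t ht) (h1 t ht) (h2 t ht) (e1 t ht) (e2 t ht) hu⟩
  have hB : ∀ t, 1 < t → IsGreatest (ascentRatio p t '' Ioi t) (ascentRatio p t (ξ₂ t)) :=
    fun t ht => ⟨mem_image_of_mem _ (h2 t ht), by
      rintro _ ⟨u, hu, rfl⟩
      exact isMaxOn_ascentRatio hp ht (h0 t ht) (h1 t ht) (h2 t ht) (e1 t ht) (e2 t ht) hu⟩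
  obtain ⟨τ, hτ, heq, hlow, hhigh⟩ := exists_threshold hp hp2 hA hB
  have hval : ∀ t, 1 < t →
      ((p * t - ξ₁ t) * |ξ₁ t - t| ^ (p - 2) = (p * t - ξ₂ t) * |ξ₂ t - t| ^ (p - 2) ↔
        descentRatio p t (ξ₁ t) = ascentRatio p t (ξ₂ t)) := fun t ht => by
    rw [charValue_eq_descentRatio hp ht (h0 t ht) (h1 t ht) (e1 t ht),
      charValue_eq_ascentRatio hp ht (h2 t ht) (e2 t ht)]
    exact mul_right_inj' (by linarith)
  have hsep : ∀ t, τ ≤ t → Separates p t (ascentRatio p t (ξ₂ t)) := by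
    intro t htt
    have ht : 1 < t := hτ.trans_le htt
    refine ⟨ascentRatio_pos hp ht (h2 t ht), fun u hu => ?_, fun u hu hu1 => ?_⟩
    · have := Real.one_lt_rpow (by linarith : 1 < u) (by linarith : 0 < p)
      rw [← div_le_iff₀ (by linarith)]
      exact (hB t ht).2 (mem_image_of_mem _ hu)
    · have := Real.rpow_lt_one hu hu1 (by linarith : 0 < p)
      rw [← le_div_iff₀ (by linarith)]
      refine le_trans ?_ ((hA t ht).2 (mem_image_of_mem _ ⟨hu, hu1⟩))
      rcases htt.eq_or_lt with rfl | htt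
      · exact heq.ge
      · exact (hhigh t htt).le
  have hopt : ∀ f : PowerSeries ℂ, Mem p f → f ≠ 0 → ∀ t, IsOpt p f t → ‖t‖ < τ := by
    intro f hf hf0 t ht
    by_contra! htτ
    have htn : 1 < ‖t‖ := hτ.trans_le htτ
    have htn0 : (‖t‖ : ℂ) ≠ 0 := by
      rw [Complex.ofReal_ne_zero]; linarith
    -- The direction `w = t / |t|` writes a complex optimum as `|t| w`, to which the real parameter
    -- |t| ≥ τ applies.
    have := (hsep ‖t‖ htτ).tsum_pairing_neg hp hp2 htn hf hf0 (w := t / ‖t‖) (by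
      rw [norm_div, Complex.norm_real, norm_norm, div_self (by linarith)])
    rw [mul_div_cancel₀ _ htn0, ht.tsum_pairing_eq_zero hp hf] at this
    exact this.false
  have hpoly : ∀ (f : Polynomial ℂ) t, f ≠ 0 → IsOpt p (f : PowerSeries ℂ) t → ‖t‖ ≤ τ :=
    fun f t hf ht => (hopt f (mem_coe_polynomial hp f) (by simpa using hf) t ht).le
  have hTle : ∀ d, T p d ≤ τ := T_le (by linarith) hpoly
  have hTlow : ∀ t, t < τ → ∀ᶠ d in atTop, t < T p d := by
    intro t ht
    -- The intermediate s must also exceed 1, since the ratios are compared only there.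
    obtain ⟨s, hs, hsτ⟩ := exists_between (max_lt ht hτ)
    have hs1 : 1 < s := (le_max_right _ _).trans_lt hs
    filter_upwards [eventually_le_T hp hs1 hpoly ⟨(h0 s hs1).le, h1 s hs1⟩ (h2 s hs1)
      (hlow s hs1 hsτ)] with d hd
    exact ((le_max_left _ _).trans_lt hs).trans_le hd
  have htau : τ = tau p := by
    refine le_antisymm (le_of_forall_lt fun t ht => ?_) (ciSup_le fun d => hTle d)
    obtain ⟨d, hd, hd1⟩ := ((hTlow t ht).and (eventually_ge_atTop 1)).exists
    exact hd.trans_le (le_ciSup (f := fun d : ℕ+ => T p d)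
      ⟨τ, by rintro _ ⟨d, rfl⟩; exact hTle d⟩ ⟨d, hd1⟩)
  refine ⟨ξ₁, ξ₂, fun t ht => ⟨(h1 t ht).trans (ht.trans (h2 t ht)), setOf_charEq hp (h0 t ht)
    ((h1 t ht).trans (ht.trans (h2 t ht))) (e1 t ht) (e2 t ht)⟩, τ,
    ⟨hτ, (hval τ hτ).2 heq⟩, fun t ht h => ?_, htau, ?_, ?_, ?_, ?_⟩
  · have h := (hval t ht).1 h
    rcases lt_trichotomy t τ with h' | h' | h'
    · exact absurd h (hlow t ht h').ne
    · exact h'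
    · exact absurd h (hhigh t h').ne'
  · rw [← htau]
    exact tendsto_order.2 ⟨fun t ht => hTlow t ht,
      fun t ht => Eventually.of_forall fun d => (hTle d).trans_lt ht⟩
  · rw [← htau]
    exact fun f hf hf0 => not_forall_rec (hsep τ le_rfl) hp hp2 hτ hf hf0
  · rw [← htau]
    exact fun d f hf0 hd => not_forall_le_rec (hsep τ le_rfl) hp hp2 hτ hf0 hd
  · rw [← htau]
    exact fun f hf hf0 t ht => (hopt f hf hf0 t ht).ne
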